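/- Let $dA$ denote Lebesgue measure on $\mathbb C$ divided by $\pi$. Let $Q:\mathbb C\to\mathbb R\cup\{+\infty\}$ be lower semicontinuous, such that $\Sigma=\{Q<+\infty\}$ has non-empty interior, $Q$ is $C^2$-smooth in $\operatorname{Int}\Sigma$, and $$\liminf_{\zeta\to\infty}\frac{Q(\zeta)}{2\log|\zeta|}>1 .$$ Let $\sigma$ be the equilibrium measure, i.e. the minimizer of $$I_Q[\mu]=\iint_{\mathbb C^2}\log\frac1{|\zeta-\eta|}\,d\mu(\zeta)\,d\mu(\eta)+\int_{\mathbb C} Q\,d\mu$$ over all compactly supported Borel probability measures $\mu$ on $\mathbb C$, and assume that the support of $\sigma$ is contained in $\operatorname{Int}\Sigma$. For $n\ge 1$ and an inverse temperature $\beta$ let $$H_n(\zeta_1,\dots,\zeta_n)=\sum_{j\ne k}\log\frac1{|\zeta_j-\zeta_k|}+n\sum_{j=1}^nQ(\zeta_j),\qquad Z_n^\beta=\int_{\mathbb C^n}e^{-\beta H_n}\,dA(\zeta_1)\cdots dA(\zeta_n),$$ and let $\mathbf P_n^\beta$ be the Gibbs measure $d\mathbf P_n^\beta=\frac1{Z_n^\beta}e^{-\beta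 H_n}\,dA(\zeta_1)\cdots dA(\zeta_n)$ on $\mathbb C^n$, with expectation $\mathbf E_n^\beta$. The one-point function is $$\mathbf R_n^\beta(z)=\lim_{\varepsilon\to0^+}\frac{\mathbf E_n^\beta\big[\#\{j:\ |\zeta_j-z|<\varepsilon\}\big]}{\varepsilon^2}.$$ Let $(\beta_n)$ be a sequence of real numbers with $n\beta_n\to\infty$ as $n\to\infty$. Then for all sufficiently large $n$ we have $0<Z_n^{\beta_n}<\infty$, the limit defining $\mathbf R_n^{\beta_n}(z)$ exists for almost every $z\in\mathbb C$, and $\mathbf R_n^{\beta_n}$ is integrable with respect to $dA$. Moreover, for every bounded continuous function $f:\mathbb C\to\mathbb C$, $$\frac1n\int_{\mathbb C} f\cdot\mathbf R_n^{\beta_n}\,dA\;\longrightarrow\;\int_{\mathbb C} f\,d\sigma\qquad(n\to\infty).$$ -/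

import Mathlib

open MeasureTheory Filter Topology
open scoped ENNReal

namespace CoulombGas

noncomputable section

/-- Lebesgue measure in the plane divided by `π`. -/
def areaMeasure : Measure ℂ := (ENNReal.ofReal Real.pi)⁻¹ • volume

/-- The logarithmic kernel `log (1 / |ζ - η|)`, equal to `+∞` on the diagonal. -/
def logKernel (ζ η : ℂ) : EReal := ENNReal.log (‖ζ - η‖ₑ)⁻¹

/-- The integral of an extended-real function, as the integral of the positive part minus the
integral of the negative part. (It is used only where the negative part has finite integral.) -/
def extIntegral {α : Type*} [MeasurableSpace α] (μ : Measure α) (g : α → EReal) : EReal :=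
  ((∫⁻ x, (g x).toENNReal ∂μ : ℝ≥0∞) : EReal) - ((∫⁻ x, (-g x).toENNReal ∂μ : ℝ≥0∞) : EReal)

/-- The set `Σ` where the potential is finite. -/
def finiteSet (Q : ℂ → EReal) : Set ℂ := {z | Q z < ⊤}

/-- External potentials: lower semicontinuous functions with values in `ℝ ∪ {+∞}`, finite on a
set with non-empty interior, `C²` in that interior, and growing faster than `2 log |ζ|`. -/
structure IsExternalPotential (Q : ℂ → EReal) : Prop where
  ne_bot : ∀ z, Q z ≠ ⊥
  lowerSemicontinuous : LowerSemicontinuous Q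
  nonempty_interior : (interior (finiteSet Q)).Nonempty
  contDiffOn : ContDiffOn ℝ 2 (fun z => (Q z).toReal) (interior (finiteSet Q))
  growth : 1 < liminf (fun z : ℂ => Q z / ((2 * Real.log ‖z‖ : ℝ) : EReal)) (cocompact ℂ)

/-- The logarithmic `Q`-energy `∬ log (1 / |ζ - η|) dμ(ζ) dμ(η) + ∫ Q dμ`. -/
def energy (Q : ℂ → EReal) (μ : Measure ℂ) : EReal :=
  extIntegral (μ.prod μ) (fun p => logKernel p.1 p.2) + extIntegral μ Q

/-- `σ` minimizes the `Q`-energy among all compactly supported Borel probability measures. -/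
structure IsEquilibriumMeasure (Q : ℂ → EReal) (σ : Measure ℂ) : Prop where
  isProbabilityMeasure : IsProbabilityMeasure σ
  isCompact_support : IsCompact σ.support
  energy_le : ∀ μ : Measure ℂ, IsProbabilityMeasure μ → IsCompact μ.support →
    energy Q σ ≤ energy Q μ

/-- The Hamiltonian `∑_{j ≠ k} log (1 / |ζ_j - ζ_k|) + n ∑_j Q(ζ_j)`. -/
def hamiltonian (Q : ℂ → EReal) (n : ℕ) (ζ : Fin n → ℂ) : EReal :=
  (∑ p ∈ (Finset.univ : Finset (Fin n)).offDiag, logKernel (ζ p.1) (ζ p.2))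
    + (n : EReal) * ∑ j, Q (ζ j)

/-- The Boltzmann factor `exp (-β H_n)`, equal to `0` where `H_n = +∞` (for `β > 0`). -/
def boltzmannFactor (Q : ℂ → EReal) (n : ℕ) (β : ℝ) (ζ : Fin n → ℂ) : ℝ≥0∞ :=
  EReal.exp (-((β : EReal) * hamiltonian Q n ζ))

/-- The partition function `Z_n^β`. -/
def partitionFunction (Q : ℂ → EReal) (n : ℕ) (β : ℝ) : ℝ≥0∞ :=
  ∫⁻ ζ, boltzmannFactor Q n β ζ ∂(Measure.pi fun _ : Fin n => areaMeasure)

/-- The Gibbs measure `(Z_n^β)⁻¹ exp (-β H_n) dA_n` on `ℂⁿ`. -/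
def gibbsMeasure (Q : ℂ → EReal) (n : ℕ) (β : ℝ) : Measure (Fin n → ℂ) :=
  (partitionFunction Q n β)⁻¹ •
    (Measure.pi fun _ : Fin n => areaMeasure).withDensity (boltzmannFactor Q n β)

/-- The expected number of indices `j` with `ζ_j ∈ W`, under the Gibbs measure. -/
def expectedCount (Q : ℂ → EReal) (n : ℕ) (β : ℝ) (W : Set ℂ) : ℝ :=
  ∫ ζ, (({j | ζ j ∈ W} : Set (Fin n)).ncard : ℝ) ∂(gibbsMeasure Q n β)

/-- The one-point function `lim_{ε → 0} E_n^β[#(D(z; ε) ∩ {ζ_j})] / ε²`. -/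
def onePointFunction (Q : ℂ → EReal) (n : ℕ) (β : ℝ) (z : ℂ) : ℝ :=
  limUnder (𝓝[>] (0 : ℝ)) fun ε => expectedCount Q n β (Metric.ball z ε) / ε ^ 2

end

end CoulombGas

open CoulombGas

/-!
The theorem holds because the Boltzmann factor is `exp (-β n² (energy + o(1)))` and `β_n n²` grows
faster than `n`, so that every effect that is exponential in `n` is negligible, and the Gibbs
measure concentrates on configurations of almost minimal energy.

**A nonnegative energy.** By the growth assumption, `Q ≥ (2 + 2a) log (1 + |z|) - C` for some
`a > 0` (`exists_growthLog_bound`). Moving the terms `log (1 + |z|)` from the potential to the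
kernel replaces `log (1 / |x - y|)` by `posKernel x y = log ((1 + |x|) (1 + |y|) / |x - y|) ≥ 0` and
`Q` by `posPotential Q C = Q - 2 log (1 + |z|) + C ≥ 2a log (1 + |z|)`. The energy and the
Hamiltonian only change by constants (`energy_eq_posEnergy_sub`, `boltzmannFactor_eq`), and become
integrals and sums in `ℝ≥0∞`. By truncation, `σ` minimizes `posEnergy` among all probability
measures, compactly supported or not (`posEnergy_le`).

**Lower bound for the partition function.** Averaging `σ` over small disks gives a measure `ν` with
bounded density, whose energy is close to that of `σ` since the logarithm is superharmonic and `Q`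
is continuous near the support of `σ` (`exists_trial_measure`). Jensen's inequality for `n`
independent points with law `ν` gives `Z ≥ exp (-β n² (I + η))`, up to a factor exponential in `n`
(`eventually_le_lintegral_expWeight`).

**Uniqueness of the minimizer.** Up to a constant, `log (1 / t)` is
`∫_1^∞ exp (-s t) ds / s - ∫_0^1 (1 - exp (-s t)) ds / s`. With `t = |x - y|²` this is a
superposition of Gaussian kernels, whose energies are weighted integrals of `|φ|²`, where `φ` is the
characteristic function. Hence the logarithmic energy is positive definite on differences of
probability measures, the energy is strictly convex, and the minimizer is unique
(`eq_of_posEnergy_le`).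

**Energy gap.** The bound on the potential makes the empirical measures of configurations with
bounded energy tight, and the truncated energy is lower semicontinuous. So if the energies of a
sequence of configurations approach the minimum, a subsequence of the empirical measures converges
weakly to `σ`. Hence, for a bounded continuous `f`, the configurations with
`|n⁻¹ ∑ f(ζ_j) - ∫ f dσ| ≥ δ` have energy at least `n² (I + c)` for some `c > 0`
(`exists_energy_gap`). Their Gibbs probability is exponentially small
(`eventually_gibbsMeasure_le`), and the means of linear statistics converge
(`tendsto_integral_gibbsMeasure`).

**The one-point function.** The intensity measure is absolutely continuous. By differentiation of
measures, the one-point function exists almost everywhere and is its density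
(`ae_tendsto_expectedCount`, `integral_mul_onePointFunction`).
-/

namespace CoulombGas

/-! ### The energy with nonnegative kernel and potential -/

/-- The reference growth `log (1 + ‖z‖)`. It is nonnegative and `‖x - y‖ ≤ (1 + ‖x‖) (1 + ‖y‖)`,
so adding it in both variables makes the logarithmic kernel nonnegative. -/
noncomputable def growthLog (z : ℂ) : ℝ := Real.log (1 + ‖z‖)

/-- The nonnegative kernel `log ((1 + ‖x‖) (1 + ‖y‖) / ‖x - y‖)`, equal to `∞` on the diagonal. -/
@[irreducible]
noncomputable def posKernel (x y : ℂ) : ℝ≥0∞ :=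
  (logKernel x y + ((growthLog x + growthLog y : ℝ) : EReal)).toENNReal

/-- The potential `Q - 2 log (1 + ‖z‖) + C`, where `C` is to be chosen such that this is
nonnegative. -/
noncomputable def posPotential (Q : ℂ → EReal) (C : ℝ) (z : ℂ) : ℝ≥0∞ :=
  (Q z + ((C - 2 * growthLog z : ℝ) : EReal)).toENNReal

/-- The energy formed with the nonnegative kernel and a nonnegative potential. It takes values in
`ℝ≥0∞` and makes sense for every measure. -/
noncomputable def posEnergy (V : ℂ → ℝ≥0∞) (μ : Measure ℂ) : ℝ≥0∞ :=
  ∫⁻ p, posKernel p.1 p.2 ∂(μ.prod μ) + ∫⁻ z, V z ∂μ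

/-- The Hamiltonian formed with the nonnegative kernel and a nonnegative potential. The last
sum compensates for the `n - 1` terms `log (1 + ‖ζ_j‖)` in the sum over pairs, against `n` such
terms in the potential. -/
noncomputable def posHamiltonian (V : ℂ → ℝ≥0∞) (n : ℕ) (ζ : Fin n → ℂ) : ℝ≥0∞ :=
  (∑ p ∈ (Finset.univ : Finset (Fin n)).offDiag, posKernel (ζ p.1) (ζ p.2))
    + n * ∑ j, V (ζ j) + 2 * ∑ j, ENNReal.ofReal (growthLog (ζ j))

lemma growthLog_nonneg (z : ℂ) : 0 ≤ growthLog z :=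
  Real.log_nonneg (by linarith [norm_nonneg z])

lemma continuous_growthLog : Continuous growthLog := by
  unfold growthLog
  exact Continuous.log (by fun_prop) fun z => by positivity

/-- `log (1 + ‖z‖)` is 1-Lipschitz. -/
lemma growthLog_add_le (z u : ℂ) : growthLog (z + u) ≤ growthLog z + ‖u‖ := by
  unfold growthLog
  have h1 : (0 : ℝ) < 1 + ‖z‖ := by positivity
  have h2 : 1 + ‖z + u‖ ≤ (1 + ‖z‖) * (1 + ‖u‖) := by
    nlinarith [norm_add_le z u, norm_nonneg z, norm_nonneg u]
  calc Real.log (1 + ‖z + u‖) ≤ Real.log ((1 + ‖z‖) * (1 + ‖u‖)) :=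
        Real.log_le_log (by positivity) h2
    _ = Real.log (1 + ‖z‖) + Real.log (1 + ‖u‖) := Real.log_mul h1.ne' (by positivity)
    _ ≤ _ := by
        have := Real.log_le_sub_one_of_pos (show (0 : ℝ) < 1 + ‖u‖ by positivity)
        linarith

lemma logKernel_self (x : ℂ) : logKernel x x = ⊤ := by simp [logKernel]

lemma logKernel_of_ne {x y : ℂ} (h : x ≠ y) :
    logKernel x y = ((-Real.log ‖x - y‖ : ℝ) : EReal) := by
  have h' : 0 < ‖x - y‖ := norm_pos_iff.2 (sub_ne_zero.2 h)
  rw [logKernel, ENNReal.log_inv, ← ofReal_norm, ENNReal.log_ofReal_of_pos h',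
    EReal.coe_neg]

lemma logKernel_comm (x y : ℂ) : logKernel x y = logKernel y x := by
  simp only [logKernel, ← ofReal_norm, norm_sub_rev x y]

lemma log_norm_sub_le (x y : ℂ) : Real.log ‖x - y‖ ≤ growthLog x + growthLog y := by
  rcases eq_or_ne x y with rfl | h
  · simpa using add_nonneg (growthLog_nonneg x) (growthLog_nonneg x)
  have h' : 0 < ‖x - y‖ := norm_pos_iff.2 (sub_ne_zero.2 h)
  rw [growthLog, growthLog, ← Real.log_mul (by positivity) (by positivity)]
  refine Real.log_le_log h' ?_
  nlinarith [norm_sub_le x y, norm_nonneg x, norm_nonneg y]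

lemma coe_posKernel (x y : ℂ) :
    (posKernel x y : EReal) = logKernel x y + ((growthLog x + growthLog y : ℝ) : EReal) := by
  rw [posKernel]
  refine EReal.coe_toENNReal ?_
  rcases eq_or_ne x y with rfl | h
  · simp only [logKernel_self, EReal.top_add_coe, le_top]
  · rw [logKernel_of_ne h, ← EReal.coe_add]
    exact EReal.coe_nonneg.2 (by linarith [log_norm_sub_le x y])

lemma posKernel_self (x : ℂ) : posKernel x x = ⊤ := by
  simp only [posKernel, logKernel_self, EReal.top_add_coe, EReal.toENNReal_top]

lemma posKernel_of_ne {x y : ℂ} (h : x ≠ y) :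
    posKernel x y = ENNReal.ofReal (growthLog x + growthLog y - Real.log ‖x - y‖) := by
  rw [posKernel, logKernel_of_ne h, ← EReal.coe_add, EReal.real_coe_toENNReal]
  congr 1; ring

lemma posKernel_comm (x y : ℂ) : posKernel x y = posKernel y x := by
  rw [posKernel, posKernel, logKernel_comm, add_comm (growthLog x)]

lemma continuous_logKernel : Continuous fun p : ℂ × ℂ => logKernel p.1 p.2 := by
  unfold logKernel
  have h : Continuous fun p : ℂ × ℂ => ‖p.1 - p.2‖ₑ := by fun_prop
  exact ENNReal.continuous_log.comp (continuous_inv.comp h)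

lemma continuous_posKernel : Continuous fun p : ℂ × ℂ => posKernel p.1 p.2 := by
  unfold posKernel
  refine EReal.continuous_toENNReal.comp (continuous_iff_continuousAt.2 fun p => ?_)
  have h : Continuous fun p : ℂ × ℂ => ((growthLog p.1 + growthLog p.2 : ℝ) : EReal) := by
    have := continuous_growthLog
    exact continuous_coe_real_ereal.comp (by fun_prop)
  exact ContinuousAt.comp (f := fun p : ℂ × ℂ => (logKernel p.1 p.2,
    ((growthLog p.1 + growthLog p.2 : ℝ) : EReal))) (EReal.continuousAt_add
      (Or.inr (EReal.coe_ne_bot _)) (Or.inr (EReal.coe_ne_top _)))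
      (continuous_logKernel.prodMk h).continuousAt

lemma measurable_posKernel : Measurable fun p : ℂ × ℂ => posKernel p.1 p.2 :=
  continuous_posKernel.measurable

@[fun_prop]
lemma measurable_posKernel_comp {α : Type*} [MeasurableSpace α] {f g : α → ℂ} (hf : Measurable f)
    (hg : Measurable g) : Measurable fun a => posKernel (f a) (g a) :=
  Measurable.comp (g := fun p : ℂ × ℂ => posKernel p.1 p.2) measurable_posKernel
    (hf.prodMk hg)

lemma lowerSemicontinuous_posPotential {Q : ℂ → EReal} (hQ : LowerSemicontinuous Q) (C : ℝ) :
    LowerSemicontinuous (posPotential Q C) := by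
  have h : Continuous fun z : ℂ => ((C - 2 * growthLog z : ℝ) : EReal) := by
    have := continuous_growthLog
    exact continuous_coe_real_ereal.comp (by fun_prop)
  refine EReal.continuous_toENNReal.comp_lowerSemicontinuous ?_
    fun _ _ => EReal.toENNReal_le_toENNReal
  exact hQ.add' h.lowerSemicontinuous fun z => EReal.continuousAt_add
      (Or.inr (EReal.coe_ne_bot _)) (Or.inr (EReal.coe_ne_top _))

/-- The growth condition at infinity, together with lower semicontinuity, gives a global lower
bound by a multiple of `log (1 + ‖z‖)` that is strictly larger than `2`. -/
lemma exists_growthLog_bound {Q : ℂ → EReal} (hQ : IsExternalPotential Q) :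
    ∃ a : ℝ, 0 < a ∧ ∃ C : ℝ, ∀ z, (((2 + 2 * a) * growthLog z - C : ℝ) : EReal) ≤ Q z := by
  obtain ⟨r, hr1, hr⟩ := EReal.lt_iff_exists_real_btwn.1 hQ.growth
  have hr1' : 1 < r := by exact_mod_cast hr1
  have hev := eventually_lt_of_lt_liminf hr
  have hbig : ∀ᶠ z : ℂ in cocompact ℂ, 2 ≤ ‖z‖ :=
    tendsto_norm_cocompact_atTop.eventually_ge_atTop 2
  have hout : ∀ᶠ z : ℂ in cocompact ℂ,
      ((2 * r * growthLog z - 2 * r * Real.log 2 : ℝ) : EReal) ≤ Q z := by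
    filter_upwards [hev, hbig] with z h1 h2
    have hlog : 0 < 2 * Real.log ‖z‖ := by have := Real.log_pos (by linarith : 1 < ‖z‖); linarith
    have h3 : (r : EReal) * ((2 * Real.log ‖z‖ : ℝ) : EReal) ≤ Q z :=
      ((EReal.lt_div_iff (by exact_mod_cast hlog) (EReal.coe_ne_top _)).1 h1).le
    refine le_trans ?_ h3
    rw [← EReal.coe_mul, EReal.coe_le_coe_iff]
    have h4 : growthLog z ≤ Real.log 2 + Real.log ‖z‖ := by
      rw [growthLog, ← Real.log_mul (by norm_num) (by linarith)]
      exact Real.log_le_log (by positivity) (by linarith)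
    nlinarith
  obtain ⟨K, hK, hKo⟩ := (hasBasis_cocompact.eventually_iff).1 hout
  have hin : ∃ m : ℝ, ∀ z ∈ K, ((m : ℝ) : EReal) ≤ Q z := by
    rcases K.eq_empty_or_nonempty with rfl | hne
    · exact ⟨0, by simp⟩
    obtain ⟨z₀, -, hz₀⟩ := hQ.lowerSemicontinuous.lowerSemicontinuousOn K
      |>.exists_isMinOn hne hK
    obtain ⟨m, -, hm⟩ := EReal.lt_iff_exists_real_btwn.1 (bot_lt_iff_ne_bot.2 (hQ.ne_bot z₀))
    exact ⟨m, fun z hz => hm.le.trans (hz₀ hz)⟩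
  obtain ⟨m, hm⟩ := hin
  obtain ⟨D, hD⟩ := hK.bddAbove_image continuous_growthLog.continuousOn
  refine ⟨r - 1, by linarith, max (2 * r * Real.log 2) (2 * r * D - m), fun z => ?_⟩
  by_cases hz : z ∈ K
  · refine le_trans ?_ (hm z hz)
    rw [EReal.coe_le_coe_iff]
    have h1 := hD (Set.mem_image_of_mem growthLog hz)
    have h2 := le_max_right (2 * r * Real.log 2) (2 * r * D - m)
    nlinarith
  · refine le_trans ?_ (hKo hz)
    rw [EReal.coe_le_coe_iff]
    have h2 := le_max_left (2 * r * Real.log 2) (2 * r * D - m)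
    linarith

section Shift

variable {Q : ℂ → EReal} {a C : ℝ}

lemma coe_posPotential (ha : 0 < a)
    (hC : ∀ z, (((2 + 2 * a) * growthLog z - C : ℝ) : EReal) ≤ Q z) (z : ℂ) :
    (posPotential Q C z : EReal) = Q z + ((C - 2 * growthLog z : ℝ) : EReal) := by
  refine EReal.coe_toENNReal ?_
  calc (0 : EReal) ≤ ((2 * a * growthLog z : ℝ) : EReal) :=
        EReal.coe_nonneg.2 (by have := growthLog_nonneg z; positivity)
    _ = (((2 + 2 * a) * growthLog z - C : ℝ) : EReal) + ((C - 2 * growthLog z : ℝ) : EReal) := by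
        rw [← EReal.coe_add]; congr 1; ring
    _ ≤ _ := add_le_add_left (hC z) _

lemma growthLog_le_posPotential
    (hC : ∀ z, (((2 + 2 * a) * growthLog z - C : ℝ) : EReal) ≤ Q z) (z : ℂ) :
    ENNReal.ofReal (2 * a * growthLog z) ≤ posPotential Q C z := by
  rw [← EReal.real_coe_toENNReal]
  refine EReal.toENNReal_le_toENNReal ?_
  calc ((2 * a * growthLog z : ℝ) : EReal)
    _ = (((2 + 2 * a) * growthLog z - C : ℝ) : EReal) + ((C - 2 * growthLog z : ℝ) : EReal) := by
        rw [← EReal.coe_add]; congr 1; ring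
    _ ≤ _ := add_le_add_left (hC z) _

end Shift

/-! ### Comparison with the given energy and Hamiltonian -/

lemma coe_sum_ennreal {ι : Type*} (s : Finset ι) (f : ι → ℝ≥0∞) :
    ((∑ i ∈ s, f i : ℝ≥0∞) : EReal) = ∑ i ∈ s, (f i : EReal) := by
  classical
  induction s using Finset.induction_on with
  | empty => simp
  | insert i s hi ih => rw [Finset.sum_insert hi, Finset.sum_insert hi, EReal.coe_ennreal_add, ih]

lemma coe_sum_real {ι : Type*} (s : Finset ι) (f : ι → ℝ) :
    ((∑ i ∈ s, f i : ℝ) : EReal) = ∑ i ∈ s, (f i : EReal) := by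
  classical
  induction s using Finset.induction_on with
  | empty => simp
  | insert i s hi ih => rw [Finset.sum_insert hi, Finset.sum_insert hi, EReal.coe_add, ih]

lemma sum_offDiag_add (n : ℕ) (f : Fin n → ℝ) :
    ∑ p ∈ (Finset.univ : Finset (Fin n)).offDiag, (f p.1 + f p.2)
      = 2 * (n - 1) * ∑ j, f j := by
  have h1 : ∑ p ∈ (Finset.univ : Finset (Fin n)) ×ˢ Finset.univ, (f p.1 + f p.2)
      = 2 * n * ∑ j, f j := by
    rw [Finset.sum_product]
    simp only [Finset.sum_add_distrib, Finset.sum_const, Finset.card_univ, Fintype.card_fin,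
      nsmul_eq_mul, ← Finset.mul_sum]
    ring
  rw [← Finset.diag_union_offDiag, Finset.sum_union (Finset.disjoint_diag_offDiag _),
    Finset.sum_diag] at h1
  have h2 : ∑ i, (f i + f i) = 2 * ∑ j, f j := by rw [Finset.mul_sum]; congr with i; ring
  dsimp only at h1
  linarith

section Shift

variable {Q : ℂ → EReal} {a C : ℝ}

/-- Passing to the nonnegative kernel and potential changes the Hamiltonian by a constant. -/
lemma hamiltonian_add_const (ha : 0 < a)
    (hC : ∀ z, (((2 + 2 * a) * growthLog z - C : ℝ) : EReal) ≤ Q z) (n : ℕ) (ζ : Fin n → ℂ) :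
    (posHamiltonian (posPotential Q C) n ζ : EReal)
      = hamiltonian Q n ζ + ((C * n ^ 2 : ℝ) : EReal) := by
  have hn : (0 : EReal) ≤ n := by exact_mod_cast Nat.zero_le n
  have hn' : (n : EReal) ≠ ⊤ := EReal.natCast_ne_top n
  have hcast : ((n : ℝ≥0∞) : EReal) = (n : EReal) := by
    rw [← ENNReal.ofReal_natCast, EReal.coe_ennreal_ofReal, max_eq_left n.cast_nonneg,
      EReal.coe_natCast]
  have hL : (((2 * ∑ j, ENNReal.ofReal (growthLog (ζ j)) : ℝ≥0∞)) : EReal)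
      = ((2 * ∑ j, growthLog (ζ j) : ℝ) : EReal) := by
    rw [← ENNReal.ofReal_sum_of_nonneg fun _ _ => growthLog_nonneg _,
      show (2 : ℝ≥0∞) = ENNReal.ofReal 2 by simp, ← ENNReal.ofReal_mul zero_le_two,
      EReal.coe_ennreal_ofReal, max_eq_left]
    exact mul_nonneg zero_le_two (Finset.sum_nonneg fun _ _ => growthLog_nonneg _)
  unfold posHamiltonian hamiltonian
  rw [EReal.coe_ennreal_add, EReal.coe_ennreal_add, EReal.coe_ennreal_mul, hL, coe_sum_ennreal,
    coe_sum_ennreal]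
  simp only [coe_posKernel, coe_posPotential ha hC, Finset.sum_add_distrib]
  rw [← coe_sum_real, ← coe_sum_real,
    sum_offDiag_add n fun j => growthLog (ζ j), show ((n : ℝ≥0∞) : EReal) = (n : EReal) from hcast,
    EReal.left_distrib_of_nonneg_of_ne_top hn hn',
    ← EReal.coe_natCast, ← EReal.coe_mul]
  have key : ∀ (A B : EReal) (r s t u : ℝ), r + s + t = u →
      A + (r : EReal) + (B + (s : EReal)) + (t : EReal) = A + B + (u : EReal) := by
    rintro A B r s t u rfl
    push_cast
    abel
  refine key _ _ _ _ _ _ ?_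
  rw [Finset.sum_sub_distrib, Finset.sum_const, Finset.card_univ, Fintype.card_fin, nsmul_eq_mul,
    ← Finset.mul_sum]
  ring

/-- The Boltzmann factor `exp (-β g)` as a function of a nonnegative Hamiltonian `g`. -/
noncomputable def expWeight (β : ℝ) (g : ℝ≥0∞) : ℝ≥0∞ := EReal.exp (-((β : EReal) * (g : EReal)))

lemma boltzmannFactor_eq (ha : 0 < a)
    (hC : ∀ z, (((2 + 2 * a) * growthLog z - C : ℝ) : EReal) ≤ Q z) (n : ℕ) {β : ℝ} (hβ : 0 ≤ β)
    (ζ : Fin n → ℂ) :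
    boltzmannFactor Q n β ζ = ENNReal.ofReal (Real.exp (β * (C * n ^ 2)))
      * expWeight β (posHamiltonian (posPotential Q C) n ζ) := by
  have h := hamiltonian_add_const ha hC n ζ
  have h' : hamiltonian Q n ζ
      = posHamiltonian (posPotential Q C) n ζ + ((-(C * n ^ 2) : ℝ) : EReal) := by
    rw [h, add_assoc, ← EReal.coe_add]
    simp
  rw [boltzmannFactor, expWeight, h', EReal.left_distrib_of_nonneg_of_ne_top
    (EReal.coe_nonneg.2 hβ) (EReal.coe_ne_top _), ← EReal.coe_mul,
    EReal.neg_add (Or.inr (EReal.coe_ne_top _)) (Or.inr (EReal.coe_ne_bot _)),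
    sub_eq_add_neg, EReal.exp_add, mul_comm, ← EReal.coe_neg, EReal.exp_coe]
  congr 3
  ring

end Shift

/-- If adding an integrable function makes `g` nonnegative, then the integral of `g` is computed by
adding and subtracting. -/
lemma extIntegral_eq_lintegral_sub {α : Type*} [MeasurableSpace α] {μ : Measure α}
    {g : α → EReal} {r : α → ℝ} {k : α → ℝ≥0∞} (hg : Measurable g)
    (hr : Measurable r) (hri : Integrable r μ)
    (h : ∀ x, (k x : EReal) = g x + (r x : EReal)) :
    extIntegral μ g = (∫⁻ x, k x ∂μ : ℝ≥0∞) - ((∫ x, r x ∂μ : ℝ) : EReal) := by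
  have hg' : ∀ x, g x = k x + ((-r x : ℝ) : EReal) := fun x => by
    rw [h, add_assoc, ← EReal.coe_add]; simp
  have hneg : ∀ x, (-g x).toENNReal ≤ ENNReal.ofReal (r x) := fun x => by
    rw [← EReal.real_coe_toENNReal]
    refine EReal.toENNReal_le_toENNReal ?_
    rw [hg', EReal.neg_le, ← EReal.coe_neg]
    exact le_add_of_nonneg_left (EReal.coe_ennreal_nonneg _)
  have hpt : ∀ x, (g x).toENNReal + ENNReal.ofReal (r x)
      = k x + (-g x).toENNReal + ENNReal.ofReal (-r x) := fun x => by
    rw [hg' x]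
    generalize r x = t
    rcases eq_or_ne (k x) ⊤ with hkx | hkx
    · rw [hkx]
      simp [-EReal.coe_neg]
    · obtain ⟨s, hs⟩ : ∃ s : NNReal, (s : ℝ≥0∞) = k x := ⟨_, ENNReal.coe_toNNReal hkx⟩
      rw [← hs, EReal.coe_nnreal_eq_coe_real, ← EReal.coe_add, ← EReal.coe_neg,
        EReal.real_coe_toENNReal, EReal.real_coe_toENNReal, ← ENNReal.ofReal_coe_nnreal]
      have hs0 := s.coe_nonneg
      have hmax : ∀ y : ℝ, ENNReal.ofReal y = ENNReal.ofReal (max y 0) := fun y => by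
        rw [ENNReal.ofReal_max, ENNReal.ofReal_zero, max_eq_left zero_le]
      rw [hmax (_ + _), hmax t, hmax (-_), hmax (-t), ← ENNReal.ofReal_add, ← ENNReal.ofReal_add,
        ← ENNReal.ofReal_add]
      · congr 1
        grind
      all_goals positivity
  have hsum : ∫⁻ x, (g x).toENNReal ∂μ + ∫⁻ x, ENNReal.ofReal (r x) ∂μ
      = ∫⁻ x, k x ∂μ + ∫⁻ x, (-g x).toENNReal ∂μ + ∫⁻ x, ENNReal.ofReal (-r x) ∂μ := by
    have m1 : Measurable fun x => (-g x).toENNReal :=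
      EReal.continuous_toENNReal.measurable.comp (continuous_neg.measurable.comp hg)
    rw [← lintegral_add_right _ hr.ennreal_ofReal, ← lintegral_add_right _ m1,
      ← lintegral_add_right _ (show Measurable fun x => ENNReal.ofReal (-r x) from
        hr.neg.ennreal_ofReal)]
    exact lintegral_congr hpt
  have hrp : ∫⁻ x, ENNReal.ofReal (r x) ∂μ ≠ ⊤ := hri.lintegral_lt_top.ne
  have hrn : ∫⁻ x, ENNReal.ofReal (-r x) ∂μ ≠ ⊤ := hri.neg.lintegral_lt_top.ne
  have hn : ∫⁻ x, (-g x).toENNReal ∂μ ≠ ⊤ :=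
    ((lintegral_mono hneg).trans_lt hri.lintegral_lt_top).ne
  rw [extIntegral, integral_eq_lintegral_pos_part_sub_lintegral_neg_part hri]
  generalize (∫⁻ x, (g x).toENNReal ∂μ) = P at *
  generalize (∫⁻ x, (-g x).toENNReal ∂μ) = N at *
  generalize (∫⁻ x, ENNReal.ofReal (r x) ∂μ) = R at *
  generalize (∫⁻ x, ENNReal.ofReal (-r x) ∂μ) = R' at *
  generalize (∫⁻ x, k x ∂μ) = K at *
  lift R to NNReal using hrp
  lift R' to NNReal using hrn
  lift N to NNReal using hn
  simp only [ENNReal.coe_toReal, EReal.coe_nnreal_eq_coe_real]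
  rcases eq_or_ne K ⊤ with rfl | hK
  · have hP : P = ⊤ := by
      by_contra hP
      rw [top_add, top_add] at hsum
      exact ENNReal.add_ne_top.2 ⟨hP, ENNReal.coe_ne_top⟩ hsum
    rw [hP]
    simp [sub_eq_add_neg, ← EReal.coe_neg, -EReal.coe_add]
  · have hP : P ≠ ⊤ := fun hP => by
      rw [hP, top_add] at hsum
      exact ENNReal.add_ne_top.2 ⟨ENNReal.add_ne_top.2 ⟨hK, ENNReal.coe_ne_top⟩,
        ENNReal.coe_ne_top⟩ hsum.symm
    lift P to NNReal using hP
    lift K to NNReal using hK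
    have : (P : ℝ) + R = K + N + R' := by exact_mod_cast hsum
    simp only [EReal.coe_nnreal_eq_coe_real, ← EReal.coe_sub, EReal.coe_eq_coe_iff]
    linarith

section Energy

variable {Q : ℂ → EReal} {a C : ℝ}

/-- On compactly supported probability measures the energy and the shifted energy differ by a
constant. -/
lemma energy_eq_posEnergy_sub (hQ : LowerSemicontinuous Q) (ha : 0 < a)
    (hC : ∀ z, (((2 + 2 * a) * growthLog z - C : ℝ) : EReal) ≤ Q z) (μ : Measure ℂ)
    [IsProbabilityMeasure μ] (hμ : IsCompact μ.support) :
    energy Q μ = posEnergy (posPotential Q C) μ - (C : EReal) := by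
  have hint : Integrable growthLog μ := by
    obtain ⟨D, hD⟩ := hμ.bddAbove_image continuous_growthLog.continuousOn
    refine Integrable.of_bound continuous_growthLog.aestronglyMeasurable D ?_
    filter_upwards [Measure.support_mem_ae (μ := μ)] with z hz
    rw [Real.norm_of_nonneg (growthLog_nonneg z)]
    exact hD (Set.mem_image_of_mem _ hz)
  have hm := continuous_growthLog.measurable
  have hp : Integrable (fun p : ℂ × ℂ => growthLog p.1 + growthLog p.2) (μ.prod μ) :=
    (hint.comp_fst μ).add (hint.comp_snd μ)
  have e1 := extIntegral_eq_lintegral_sub (μ := μ.prod μ) continuous_logKernel.measurable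
    (by fun_prop) hp (fun p => coe_posKernel p.1 p.2)
  have e2 := extIntegral_eq_lintegral_sub (μ := μ) hQ.measurable
    (by fun_prop)
    (r := fun z => C - 2 * growthLog z) ((integrable_const C).sub (hint.const_mul 2))
    (coe_posPotential ha hC)
  rw [energy, e1, e2, posEnergy, EReal.coe_ennreal_add,
    integral_add (hint.comp_fst μ) (hint.comp_snd μ),
    integral_sub (integrable_const C) (hint.const_mul 2), integral_const_mul,
    integral_fun_fst (f := growthLog), integral_fun_snd (f := growthLog)]
  simp only [integral_const, probReal_univ, one_smul]
  have key : ∀ (A B : EReal) (r s u : ℝ), r + s = u →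
      A - (r : EReal) + (B - (s : EReal)) = A + B - (u : EReal) := by
    rintro A B r s u rfl
    simp only [sub_eq_add_neg, ← EReal.coe_neg, neg_add]
    rw [add_add_add_comm, ← EReal.coe_add]
  exact key _ _ _ _ _ (by ring)

variable {σ : Measure ℂ}

lemma posEnergy_le_of_isCompact_support (hQ : LowerSemicontinuous Q) (ha : 0 < a)
    (hC : ∀ z, (((2 + 2 * a) * growthLog z - C : ℝ) : EReal) ≤ Q z)
    (hσ : IsEquilibriumMeasure Q σ) (μ : Measure ℂ) [IsProbabilityMeasure μ]
    (hμ : IsCompact μ.support) :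
    posEnergy (posPotential Q C) σ ≤ posEnergy (posPotential Q C) μ := by
  have := hσ.isProbabilityMeasure
  have h := hσ.energy_le μ inferInstance hμ
  rw [energy_eq_posEnergy_sub hQ ha hC σ hσ.isCompact_support,
    energy_eq_posEnergy_sub hQ ha hC μ hμ] at h
  have h2 := add_le_add_left h (C : EReal)
  rw [EReal.sub_add_cancel, EReal.sub_add_cancel] at h2
  exact EReal.coe_ennreal_le_coe_ennreal_iff.1 h2

end Energy

lemma posEnergy_smul_le {V : ℂ → ℝ≥0∞} {μ ν : Measure ℂ} [SFinite μ] [SFinite ν] {c : ℝ≥0∞}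
    (hc : 1 ≤ c) (h : ν ≤ c • μ) : posEnergy V ν ≤ c ^ 2 * posEnergy V μ := by
  have hp : ν.prod ν ≤ (c ^ 2) • (μ.prod μ) := by
    refine Measure.le_iff.2 fun s hs => ?_
    rw [Measure.smul_apply, Measure.prod_apply hs, Measure.prod_apply hs, smul_eq_mul]
    calc ∫⁻ x, ν (Prod.mk x ⁻¹' s) ∂ν ≤ ∫⁻ x, (c • μ) (Prod.mk x ⁻¹' s) ∂(c • μ) :=
          lintegral_mono' h fun x => h _
      _ = _ := by
          simp only [Measure.smul_apply, smul_eq_mul]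
          rw [lintegral_smul_measure, lintegral_const_mul _ (measurable_measure_prodMk_left hs),
            smul_eq_mul, ← mul_assoc, sq]
  unfold posEnergy
  rw [mul_add]
  refine add_le_add ?_ ?_
  · refine (lintegral_mono' hp le_rfl).trans_eq ?_
    rw [lintegral_smul_measure, smul_eq_mul]
  · refine (lintegral_mono' h le_rfl).trans ?_
    rw [lintegral_smul_measure, smul_eq_mul]
    gcongr
    exact le_self_pow₀ hc two_ne_zero

/-- The equilibrium measure minimizes the shifted energy among all probability measures, compactly
supported or not: any such measure is approximated by its normalized restrictions to large
disks. -/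
lemma posEnergy_le {Q : ℂ → EReal} {a C : ℝ} {σ : Measure ℂ}
    (hQ : LowerSemicontinuous Q) (ha : 0 < a)
    (hC : ∀ z, (((2 + 2 * a) * growthLog z - C : ℝ) : EReal) ≤ Q z)
    (hσ : IsEquilibriumMeasure Q σ) (μ : Measure ℂ) [IsProbabilityMeasure μ] :
    posEnergy (posPotential Q C) σ ≤ posEnergy (posPotential Q C) μ := by
  set K : ℕ → Set ℂ := fun k => Metric.closedBall 0 k
  have hK : Tendsto (fun k => μ (K k)) atTop (𝓝 1) := by
    have h := tendsto_measure_iUnion_atTop (μ := μ) (s := K) fun i j hij =>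
      Metric.closedBall_subset_closedBall (by exact_mod_cast hij)
    rwa [show (⋃ k, K k) = Set.univ from Metric.iUnion_closedBall_nat 0, measure_univ] at h
  have hinv : Tendsto (fun k => ((μ (K k))⁻¹) ^ 2 * posEnergy (posPotential Q C) μ) atTop
      (𝓝 ((1 : ℝ≥0∞)⁻¹ ^ 2 * posEnergy (posPotential Q C) μ)) :=
    ENNReal.Tendsto.mul_const (((ENNReal.continuous_pow 2).tendsto _).comp
      (tendsto_inv_iff.2 hK)) (Or.inl (by simp))
  rw [inv_one, one_pow, one_mul] at hinv
  refine ge_of_tendsto hinv ?_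
  filter_upwards [hK.eventually_const_lt zero_lt_one] with k hk
  set ν : Measure ℂ := (μ (K k))⁻¹ • μ.restrict (K k)
  have hν : IsProbabilityMeasure ν := ⟨by
    simp only [ν, Measure.smul_apply, Measure.restrict_apply_univ, smul_eq_mul]
    exact ENNReal.inv_mul_cancel hk.ne' (measure_ne_top _ _)⟩
  have hsupp : IsCompact ν.support := by
    refine (isCompact_closedBall (0 : ℂ) k).of_isClosed_subset Measure.isClosed_support ?_
    refine Measure.support_subset_of_isClosed Metric.isClosed_closedBall ?_
    refine Measure.ae_smul_measure (p := fun x => x ∈ Metric.closedBall (0 : ℂ) k) ?_ _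
    exact ae_restrict_mem Metric.isClosed_closedBall.measurableSet
  refine (posEnergy_le_of_isCompact_support hQ ha hC hσ ν hsupp).trans ?_
  refine posEnergy_smul_le (ENNReal.one_le_inv.2 prob_le_one) ?_
  refine Measure.le_iff.2 fun s hs => ?_
  simp only [ν, Measure.smul_apply, smul_eq_mul]
  gcongr
  exact Measure.restrict_le_self

/-! ### Circle and disk averages of the kernel -/

/-- Jensen's formula for a linear function, as an upper bound for the mean of the kernel over a
circle. The bound stays finite if the circle is centred at, or passes through, the pole. -/
lemma lintegral_posKernel_circleMap_le (x y : ℂ) {ρ : ℝ} (hρ : 0 < ρ) :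
    ∫⁻ θ in Set.Ioo (-Real.pi) Real.pi, posKernel (circleMap x ρ θ) y
      ≤ ENNReal.ofReal (2 * Real.pi) * ENNReal.ofReal
        (growthLog x + ρ + growthLog y - (Real.log ρ + Real.posLog (ρ⁻¹ * ‖x - y‖))) := by
  set c : ℝ := growthLog x + ρ + growthLog y
  set g : ℝ → ℝ := fun θ => Real.log ‖circleMap x ρ θ - y‖
  have hnorm : ∀ θ, growthLog (circleMap x ρ θ) ≤ growthLog x + ρ := fun θ => by
    have h := growthLog_add_le x (circleMap 0 ρ θ)
    rw [norm_circleMap_zero, abs_of_pos hρ] at h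
    rwa [show x + circleMap 0 ρ θ = circleMap x ρ θ by simp [circleMap]] at h
  have hper : Function.Periodic g (2 * Real.pi) := fun θ => by
    simp only [g, periodic_circleMap x ρ θ]
  have hci : IntervalIntegrable g volume 0 (2 * Real.pi) := circleIntegrable_log_norm_sub_const ρ
  have hgi : IntervalIntegrable g volume (-Real.pi) Real.pi :=
    hper.intervalIntegrable₀ Real.two_pi_pos.ne' hci _ _
  have hint : ∫ θ in (-Real.pi)..Real.pi, g θ
      = 2 * Real.pi * (Real.log ρ + Real.posLog (ρ⁻¹ * ‖x - y‖)) := by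
    have h1 := hper.intervalIntegral_add_eq (-Real.pi) 0
    rw [zero_add, show -Real.pi + 2 * Real.pi = Real.pi by ring] at h1
    have h2 := circleAverage_log_norm_sub_const_eq_log_radius_add_posLog (a := y) (c := x) hρ.ne'
    rw [Real.circleAverage_def, smul_eq_mul, inv_mul_eq_iff_eq_mul₀ Real.two_pi_pos.ne'] at h2
    rw [h1]
    exact h2
  have hF : IntegrableOn (fun θ => c - g θ) (Set.Ioo (-Real.pi) Real.pi) := by
    have := (intervalIntegrable_const (c := c)).sub hgi
    rw [intervalIntegrable_iff_integrableOn_Ioc_of_le (by linarith [Real.pi_pos])] at this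
    exact this.mono_set Set.Ioo_subset_Ioc_self
  have hF0 : ∀ θ, 0 ≤ c - g θ := fun θ => by
    have := log_norm_sub_le (circleMap x ρ θ) y
    have := hnorm θ
    simp only [c, g]
    linarith
  calc ∫⁻ θ in Set.Ioo (-Real.pi) Real.pi, posKernel (circleMap x ρ θ) y
      ≤ ∫⁻ θ in Set.Ioo (-Real.pi) Real.pi, ENNReal.ofReal (c - g θ) := by
        refine lintegral_mono_ae (ae_restrict_of_ae ?_)
        have h0 : volume (circleMap x ρ ⁻¹' {y}) = 0 :=
          ((Set.countable_singleton y).preimage_circleMap x hρ.ne').measure_zero _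
        filter_upwards [measure_eq_zero_iff_ae_notMem.1 h0] with θ hθ
        rw [posKernel_of_ne (by simpa using hθ)]
        refine ENNReal.ofReal_le_ofReal ?_
        have := hnorm θ
        simp only [c, g]
        linarith
    _ = ENNReal.ofReal (∫ θ in Set.Ioo (-Real.pi) Real.pi, (c - g θ)) :=
        (ofReal_integral_eq_lintegral_ofReal hF (ae_of_all _ hF0)).symm
    _ = ENNReal.ofReal (2 * Real.pi * (c - (Real.log ρ + Real.posLog (ρ⁻¹ * ‖x - y‖)))) := by
        rw [← integral_Ioc_eq_integral_Ioo,
          ← intervalIntegral.integral_of_le (by linarith [Real.pi_pos]),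
          intervalIntegral.integral_sub intervalIntegrable_const hgi, hint,
          intervalIntegral.integral_const, smul_eq_mul]
        congr 1
        ring
    _ = _ := ENNReal.ofReal_mul Real.two_pi_pos.le

/-- Superharmonicity of the logarithmic kernel; the error `ρ` is due to the added terms
`log (1 + ‖z‖)`. -/
lemma lintegral_posKernel_circleMap_le_add (x y : ℂ) {ρ : ℝ} (hρ : 0 < ρ) :
    ∫⁻ θ in Set.Ioo (-Real.pi) Real.pi, posKernel (circleMap x ρ θ) y
      ≤ ENNReal.ofReal (2 * Real.pi) * (posKernel x y + ENNReal.ofReal ρ) := by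
  rcases eq_or_ne x y with rfl | h
  · rw [posKernel_self, top_add, ENNReal.mul_top (by simp [Real.pi_pos])]
    exact le_top
  refine (lintegral_posKernel_circleMap_le x y hρ).trans ?_
  have hd : 0 < ‖x - y‖ := norm_pos_iff.2 (sub_ne_zero.2 h)
  rw [posKernel_of_ne h, ← ENNReal.ofReal_add (by linarith [log_norm_sub_le x y]) hρ.le]
  gcongr
  have h1 : Real.log (ρ⁻¹ * ‖x - y‖) ≤ Real.posLog (ρ⁻¹ * ‖x - y‖) := le_max_right _ _
  rw [Real.log_mul (inv_ne_zero hρ.ne') hd.ne', Real.log_inv] at h1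
  linarith

lemma lintegral_ball_polar (f : ℂ → ℝ≥0∞) (hf : Measurable f) (ε : ℝ) :
    ∫⁻ u in Metric.ball 0 ε, f u = ∫⁻ ρ in Set.Ioi (0 : ℝ), ENNReal.ofReal ρ *
      (if ρ < ε then ∫⁻ θ in Set.Ioo (-Real.pi) Real.pi, f (circleMap 0 ρ θ) else 0) := by
  have hcm : Measurable fun p : ℝ × ℝ => circleMap 0 p.1 p.2 := by
    unfold circleMap
    fun_prop
  rw [← lintegral_indicator Metric.isOpen_ball.measurableSet,
    ← Complex.lintegral_comp_polarCoord_symm,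
    show polarCoord.target = Set.Ioi (0 : ℝ) ×ˢ Set.Ioo (-Real.pi) Real.pi from rfl,
    Measure.volume_eq_prod, ← Measure.prod_restrict]
  have hsymm : ∀ p : ℝ × ℝ, Complex.polarCoord.symm p = circleMap 0 p.1 p.2 := fun p => by
    rw [Complex.polarCoord_symm_apply, circleMap_zero, Complex.exp_mul_I]
    push_cast
    ring
  simp only [hsymm]
  rw [lintegral_prod _ (by
    exact (Measurable.mul (by fun_prop)
      ((hf.indicator Metric.isOpen_ball.measurableSet).comp hcm)).aemeasurable)]
  refine setLIntegral_congr_fun measurableSet_Ioi fun ρ hρ => ?_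
  have hρ : (0 : ℝ) < ρ := hρ
  simp only [smul_eq_mul]
  have hball : ∀ θ, (circleMap 0 ρ θ ∈ Metric.ball (0 : ℂ) ε) ↔ ρ < ε := fun θ => by
    rw [mem_ball_zero_iff, norm_circleMap_zero, abs_of_pos hρ]
  split_ifs with h
  · rw [lintegral_const_mul _ (show Measurable fun θ =>
      (Metric.ball (0 : ℂ) ε).indicator f (circleMap 0 ρ θ) from
      (hf.indicator Metric.isOpen_ball.measurableSet).comp (continuous_circleMap 0 ρ).measurable)]
    congr 1
    refine lintegral_congr fun θ => ?_
    rw [Set.indicator_of_mem ((hball θ).2 h)]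
  · have : ∀ θ, (Metric.ball (0 : ℂ) ε).indicator f (circleMap 0 ρ θ) = 0 := fun θ =>
      Set.indicator_of_notMem (fun hh => h ((hball θ).1 hh)) _
    simp [this]

lemma setLIntegral_ball_posKernel_le (x y : ℂ) (ε : ℝ) :
    ∫⁻ u in Metric.ball 0 ε, posKernel (x + u) y
      ≤ volume (Metric.ball (0 : ℂ) ε) * (posKernel x y + ENNReal.ofReal ε) := by
  have hm : Measurable fun u => posKernel (x + u) y := by fun_prop
  have hc : ∫⁻ _ in Metric.ball (0 : ℂ) ε, (posKernel x y + ENNReal.ofReal ε)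
      = volume (Metric.ball (0 : ℂ) ε) * (posKernel x y + ENNReal.ofReal ε) := by
    rw [setLIntegral_const, mul_comm]
  rw [← hc, lintegral_ball_polar _ hm, lintegral_ball_polar _ measurable_const]
  refine setLIntegral_mono' measurableSet_Ioi fun ρ hρ => ?_
  have hρ : (0 : ℝ) < ρ := hρ
  gcongr ENNReal.ofReal ρ * ?_
  split_ifs with h
  · have hcm : ∀ θ, x + circleMap 0 ρ θ = circleMap x ρ θ := fun θ => by simp [circleMap]
    simp only [hcm]
    refine (lintegral_posKernel_circleMap_le_add x y hρ).trans ?_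
    rw [setLIntegral_const, Real.volume_Ioo, mul_comm,
      show Real.pi - -Real.pi = 2 * Real.pi by ring]
    gcongr
  · exact le_rfl

/-- The uniform probability measure on the disk of radius `ε` centred at the origin. -/
noncomputable def diskMeasure (ε : ℝ) : Measure ℂ :=
  (volume (Metric.ball (0 : ℂ) ε))⁻¹ • volume.restrict (Metric.ball 0 ε)

lemma isProbabilityMeasure_diskMeasure {ε : ℝ} (hε : 0 < ε) :
    IsProbabilityMeasure (diskMeasure ε) := ⟨by
  simp only [diskMeasure, Measure.smul_apply, Measure.restrict_apply_univ, smul_eq_mul]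
  exact ENNReal.inv_mul_cancel (Metric.measure_ball_pos _ _ hε).ne' measure_ball_lt_top.ne⟩

lemma ae_diskMeasure_mem_ball (ε : ℝ) : ∀ᵐ u ∂(diskMeasure ε), ‖u‖ < ε := by
  refine Measure.ae_smul_measure ?_ _
  filter_upwards [ae_restrict_mem Metric.isOpen_ball.measurableSet] with u hu
  exact mem_ball_zero_iff.1 hu

lemma lintegral_diskMeasure_posKernel_le (x y : ℂ) {ε : ℝ} (hε : 0 < ε) :
    ∫⁻ u, posKernel (x + u) y ∂(diskMeasure ε) ≤ posKernel x y + ENNReal.ofReal ε := by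
  rw [diskMeasure, lintegral_smul_measure, smul_eq_mul]
  refine (mul_le_mul_right (setLIntegral_ball_posKernel_le x y ε) _).trans_eq ?_
  rw [← mul_assoc, ENNReal.inv_mul_cancel (Metric.measure_ball_pos _ _ hε).ne'
    measure_ball_lt_top.ne, one_mul]

/-- The measure `μ` smeared out uniformly over disks of radius `ε`. -/
noncomputable def smearedMeasure (μ : Measure ℂ) (ε : ℝ) : Measure ℂ :=
  (μ.prod (diskMeasure ε)).map fun p => p.1 + p.2

section Smeared

variable (μ : Measure ℂ) {ε : ℝ}

lemma isProbabilityMeasure_smearedMeasure [IsProbabilityMeasure μ] (hε : 0 < ε) :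
    IsProbabilityMeasure (smearedMeasure μ ε) := by
  have := isProbabilityMeasure_diskMeasure hε
  exact Measure.isProbabilityMeasure_map (by fun_prop)

lemma lintegral_smearedMeasure (hε : 0 < ε) {f : ℂ → ℝ≥0∞} (hf : Measurable f) :
    ∫⁻ z, f z ∂(smearedMeasure μ ε) = ∫⁻ x, ∫⁻ u, f (x + u) ∂(diskMeasure ε) ∂μ := by
  have := isProbabilityMeasure_diskMeasure hε
  rw [smearedMeasure, lintegral_map hf (by fun_prop), lintegral_prod _ (by fun_prop)]

/-- Smearing does not increase the logarithmic energy, up to a small error. -/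
lemma lintegral_posKernel_smearedMeasure_le [IsProbabilityMeasure μ] (hε : 0 < ε) :
    ∫⁻ p, posKernel p.1 p.2 ∂((smearedMeasure μ ε).prod (smearedMeasure μ ε))
      ≤ ∫⁻ p, posKernel p.1 p.2 ∂(μ.prod μ) + 2 * ENNReal.ofReal ε := by
  have := isProbabilityMeasure_smearedMeasure μ hε
  have := isProbabilityMeasure_diskMeasure hε
  have hm := measurable_posKernel
  have hstep : ∀ y, ∫⁻ x, posKernel x y ∂(smearedMeasure μ ε)
      ≤ ∫⁻ x, posKernel x y ∂μ + ENNReal.ofReal ε := fun y => by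
    rw [lintegral_smearedMeasure μ hε (by fun_prop)]
    refine (lintegral_mono fun x => lintegral_diskMeasure_posKernel_le x y hε).trans_eq ?_
    rw [lintegral_add_right _ measurable_const, lintegral_const, measure_univ, mul_one]
  rw [lintegral_prod_symm _ hm.aemeasurable]
  calc ∫⁻ y, ∫⁻ x, posKernel x y ∂(smearedMeasure μ ε) ∂(smearedMeasure μ ε)
      ≤ ∫⁻ y, (∫⁻ x, posKernel x y ∂μ + ENNReal.ofReal ε) ∂(smearedMeasure μ ε) :=
        lintegral_mono hstep
    _ = ∫⁻ x, ∫⁻ y, posKernel y x ∂(smearedMeasure μ ε) ∂μ + ENNReal.ofReal ε := by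
        rw [lintegral_add_right _ measurable_const, lintegral_const, measure_univ, mul_one,
          lintegral_lintegral_swap (f := fun y x => posKernel x y)
            (Measurable.aemeasurable (by fun_prop))]
        simp only [posKernel_comm]
    _ ≤ ∫⁻ x, (∫⁻ y, posKernel y x ∂μ + ENNReal.ofReal ε) ∂μ + ENNReal.ofReal ε := by
        gcongr with x
        exact hstep x
    _ = _ := by
        rw [lintegral_add_right _ measurable_const, lintegral_const, measure_univ, mul_one,
          lintegral_prod_symm _ hm.aemeasurable, two_mul, add_assoc]

/-- A smeared measure has a bounded density. -/
lemma smearedMeasure_le [IsProbabilityMeasure μ] (hε : 0 < ε) :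
    smearedMeasure μ ε ≤ (volume (Metric.ball (0 : ℂ) ε))⁻¹ • volume := by
  have := isProbabilityMeasure_diskMeasure hε
  refine Measure.le_iff.2 fun s hs => ?_
  rw [← lintegral_indicator_one hs,
    lintegral_smearedMeasure μ hε (measurable_one.indicator hs), Measure.smul_apply, smul_eq_mul]
  have : ∀ x, ∫⁻ u, s.indicator 1 (x + u) ∂(diskMeasure ε)
      ≤ (volume (Metric.ball (0 : ℂ) ε))⁻¹ * volume s := fun x => by
    rw [diskMeasure, lintegral_smul_measure, smul_eq_mul]
    gcongr
    refine (setLIntegral_le_lintegral _ _).trans_eq ?_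
    rw [lintegral_add_left_eq_self (s.indicator (1 : ℂ → ℝ≥0∞)) x, lintegral_indicator_one hs]
  refine (lintegral_mono this).trans_eq ?_
  rw [lintegral_const, measure_univ, mul_one]

lemma ae_smearedMeasure {p : ℂ → Prop} {K : Set ℂ} (hε : 0 < ε) (hK : ∀ᵐ x ∂μ, x ∈ K)
    (hp : MeasurableSet {z | p z}) (h : ∀ x ∈ K, ∀ u, ‖u‖ < ε → p (x + u)) :
    ∀ᵐ z ∂(smearedMeasure μ ε), p z := by
  have := isProbabilityMeasure_diskMeasure hε
  rw [smearedMeasure, ae_map_iff (by fun_prop) hp]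
  have h1 : ∀ᵐ q ∂(μ.prod (diskMeasure ε)), q.1 ∈ K :=
    Measure.quasiMeasurePreserving_fst.ae hK
  have h2 : ∀ᵐ q ∂(μ.prod (diskMeasure ε)), ‖q.2‖ < ε :=
    Measure.quasiMeasurePreserving_snd.ae (ae_diskMeasure_mem_ball ε)
  filter_upwards [h1, h2] with q hq1 hq2 using h _ hq1 _ hq2

end Smeared

/-! ### Finiteness of the minimal energy, and trial measures with bounded density -/

section Trial

variable {Q : ℂ → EReal} {a C : ℝ} {σ : Measure ℂ}

lemma posPotential_of_mem_finiteSet (hQ : ∀ z, Q z ≠ ⊥) (C : ℝ) {z : ℂ} (hz : z ∈ finiteSet Q) :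
    posPotential Q C z = ENNReal.ofReal ((Q z).toReal + (C - 2 * growthLog z)) := by
  have hz : Q z ≠ ⊤ := ne_of_lt hz
  rw [posPotential, ← EReal.coe_toReal hz (hQ z), ← EReal.coe_add, EReal.real_coe_toENNReal,
    EReal.toReal_coe]

lemma continuousOn_toReal_add_growthLog (hQ : IsExternalPotential Q) (C : ℝ) :
    ContinuousOn (fun z => (Q z).toReal + (C - 2 * growthLog z)) (interior (finiteSet Q)) := by
  have := continuous_growthLog
  exact hQ.contDiffOn.continuousOn.add (by fun_prop)

lemma exists_posPotential_le_of_isCompact (hQ : IsExternalPotential Q) (C : ℝ) {K : Set ℂ}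
    (hK : IsCompact K) (hKQ : K ⊆ interior (finiteSet Q)) :
    ∃ D : ℝ≥0∞, D ≠ ⊤ ∧ ∀ z ∈ K, posPotential Q C z ≤ D := by
  obtain ⟨D, hD⟩ := hK.bddAbove_image ((continuousOn_toReal_add_growthLog hQ C).mono hKQ)
  refine ⟨ENNReal.ofReal D, ENNReal.ofReal_ne_top, fun z hz => ?_⟩
  rw [posPotential_of_mem_finiteSet hQ.ne_bot C (interior_subset (hKQ hz))]
  exact ENNReal.ofReal_le_ofReal (hD (Set.mem_image_of_mem _ hz))

/-- The uniform measure on a small circle in the interior of `{Q < ∞}` has finite energy. -/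
lemma posEnergy_lt_top (hQ : IsExternalPotential Q) (ha : 0 < a)
    (hC : ∀ z, (((2 + 2 * a) * growthLog z - C : ℝ) : EReal) ≤ Q z)
    (hσ : IsEquilibriumMeasure Q σ) : posEnergy (posPotential Q C) σ < ⊤ := by
  obtain ⟨c, hc⟩ := hQ.nonempty_interior
  obtain ⟨ρ, hρ, hball⟩ := Metric.nhds_basis_closedBall.mem_iff.1
    (isOpen_interior.mem_nhds hc)
  set τ : Measure ℝ := (ENNReal.ofReal (2 * Real.pi))⁻¹ •
    volume.restrict (Set.Ioo (-Real.pi) Real.pi)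
  have hπ : ENNReal.ofReal (2 * Real.pi) ≠ 0 := by simp [Real.pi_pos]
  have hτ : IsProbabilityMeasure τ := ⟨by
    simp only [τ, Measure.smul_apply, Measure.restrict_apply_univ, smul_eq_mul, Real.volume_Ioo]
    rw [show Real.pi - -Real.pi = 2 * Real.pi by ring]
    exact ENNReal.inv_mul_cancel hπ ENNReal.ofReal_ne_top⟩
  have hcm : Measurable (circleMap c ρ) := (continuous_circleMap c ρ).measurable
  set μ : Measure ℂ := τ.map (circleMap c ρ)
  have hμ : IsProbabilityMeasure μ := Measure.isProbabilityMeasure_map hcm.aemeasurable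
  have hmem : ∀ᵐ z ∂μ, z ∈ Metric.closedBall c ρ := by
    refine (ae_map_iff hcm.aemeasurable Metric.isClosed_closedBall.measurableSet).2 ?_
    exact ae_of_all _ fun θ => circleMap_mem_closedBall c hρ.le θ
  refine (posEnergy_le hQ.lowerSemicontinuous ha hC hσ μ).trans_lt ?_
  refine ENNReal.add_lt_top.2 ⟨?_, ?_⟩
  · set B : ℝ≥0∞ := ENNReal.ofReal (growthLog c + ρ + (growthLog c + ρ) - Real.log ρ)
    have hB : ∀ᵐ y ∂μ, ∫⁻ x, posKernel x y ∂μ ≤ B := by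
      filter_upwards [hmem] with y hy
      rw [lintegral_map (by fun_prop) hcm, lintegral_smul_measure, smul_eq_mul]
      refine (mul_le_mul_right (lintegral_posKernel_circleMap_le c y hρ) _).trans ?_
      rw [← mul_assoc, ENNReal.inv_mul_cancel hπ ENNReal.ofReal_ne_top, one_mul]
      refine ENNReal.ofReal_le_ofReal ?_
      have h1 := growthLog_add_le c (y - c)
      rw [add_sub_cancel] at h1
      have h2 : ‖y - c‖ ≤ ρ := mem_closedBall_iff_norm.1 hy
      have h3 : 0 ≤ Real.posLog (ρ⁻¹ * ‖c - y‖) := Real.posLog_nonneg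
      linarith
    rw [lintegral_prod_symm _ measurable_posKernel.aemeasurable]
    refine (lintegral_mono_ae hB).trans_lt ?_
    rw [lintegral_const, measure_univ, mul_one]
    exact ENNReal.ofReal_lt_top
  · obtain ⟨D, hD, hDle⟩ := exists_posPotential_le_of_isCompact hQ C
      (isCompact_closedBall c ρ) hball
    have : ∀ᵐ z ∂μ, posPotential Q C z ≤ D := by
      filter_upwards [hmem] with z hz using hDle z hz
    refine (lintegral_mono_ae this).trans_lt ?_
    rw [lintegral_const, measure_univ, mul_one]
    exact hD.lt_top

/-- Smearing out the equilibrium measure gives measures of bounded density whose energy is as close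
to the minimum as desired. Here the continuity of the potential near the support is used. -/
lemma exists_trial_measure (hQ : IsExternalPotential Q) (C : ℝ) [IsProbabilityMeasure σ]
    (hσ : IsCompact σ.support) (hS : σ.support ⊆ interior (finiteSet Q)) {η : ℝ} (hη : 0 < η) :
    ∃ ν : Measure ℂ, IsProbabilityMeasure ν ∧
      (∃ M : ℝ≥0∞, M ≠ 0 ∧ M ≠ ⊤ ∧ ν ≤ M • areaMeasure) ∧
      posEnergy (posPotential Q C) ν ≤ posEnergy (posPotential Q C) σ + ENNReal.ofReal η ∧
      ∫⁻ z, ENNReal.ofReal (growthLog z) ∂ν < ⊤ := by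
  obtain ⟨δ, hδ, hδS⟩ := hσ.exists_cthickening_subset_open isOpen_interior hS
  have hcpt : IsCompact (Metric.cthickening δ σ.support) := hσ.cthickening
  set v : ℂ → ℝ := fun z => (Q z).toReal + (C - 2 * growthLog z)
  have hv : UniformContinuousOn v (Metric.cthickening δ σ.support) :=
    hcpt.uniformContinuousOn_of_continuous ((continuousOn_toReal_add_growthLog hQ C).mono hδS)
  obtain ⟨δ', hδ', hvδ⟩ := Metric.uniformContinuousOn_iff.1 hv (η / 3) (by positivity)
  set ε := min (min δ δ') (η / 3)
  have hε : 0 < ε := by positivity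
  have hεδ : ε ≤ δ := (min_le_left _ _).trans (min_le_left _ _)
  have hεδ' : ε ≤ δ' := (min_le_left _ _).trans (min_le_right _ _)
  have hεη : ε ≤ η / 3 := min_le_right _ _
  have hnear : ∀ x ∈ σ.support, ∀ u, ‖u‖ < ε → x + u ∈ Metric.cthickening δ σ.support := by
    intro x hx u hu
    refine Metric.mem_cthickening_of_dist_le _ x _ _ hx ?_
    rw [dist_eq_norm, add_sub_cancel_left]
    exact (hu.trans_le hεδ).le
  have hVnear : ∀ x ∈ σ.support, ∀ u, ‖u‖ < ε →
      posPotential Q C (x + u) ≤ posPotential Q C x + ENNReal.ofReal (η / 3) := by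
    intro x hx u hu
    have h1 := hnear x hx u hu
    have h2 := Metric.self_subset_cthickening (δ := δ) σ.support hx
    rw [posPotential_of_mem_finiteSet hQ.ne_bot C (interior_subset (hδS h1)),
      posPotential_of_mem_finiteSet hQ.ne_bot C (interior_subset (hδS h2))]
    refine (ENNReal.ofReal_le_ofReal ?_).trans ENNReal.ofReal_add_le
    have h3 := hvδ _ h1 _ h2 (by
      rw [dist_eq_norm, add_sub_cancel_left]; exact hu.trans_le hεδ')
    have h4 := (abs_lt.1 (Real.dist_eq _ _ ▸ h3)).2
    simp only [v] at h4
    linarith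
  have hsupp : ∀ᵐ x ∂σ, x ∈ σ.support := Measure.support_mem_ae
  have hdisk := isProbabilityMeasure_diskMeasure hε
  have hprob := isProbabilityMeasure_smearedMeasure σ hε
  have hVm : Measurable (posPotential Q C) :=
    (lowerSemicontinuous_posPotential hQ.lowerSemicontinuous C).measurable
  refine ⟨smearedMeasure σ ε, hprob,
    ⟨(volume (Metric.ball (0 : ℂ) ε))⁻¹ * ENNReal.ofReal Real.pi, ?_, ?_, ?_⟩, ?_, ?_⟩
  · exact mul_ne_zero (ENNReal.inv_ne_zero.2 measure_ball_lt_top.ne)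
      (ENNReal.ofReal_pos.2 Real.pi_pos).ne'
  · exact ENNReal.mul_ne_top (ENNReal.inv_ne_top.2 (Metric.measure_ball_pos _ _ hε).ne')
      ENNReal.ofReal_ne_top
  · rw [areaMeasure, smul_smul, mul_assoc, ENNReal.mul_inv_cancel
      (ENNReal.ofReal_pos.2 Real.pi_pos).ne' ENNReal.ofReal_ne_top, mul_one]
    exact smearedMeasure_le σ hε
  · have hV : ∫⁻ z, posPotential Q C z ∂(smearedMeasure σ ε)
        ≤ ∫⁻ z, posPotential Q C z ∂σ + ENNReal.ofReal (η / 3) := by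
      rw [lintegral_smearedMeasure σ hε hVm]
      calc ∫⁻ x, ∫⁻ u, posPotential Q C (x + u) ∂(diskMeasure ε) ∂σ
          ≤ ∫⁻ x, (posPotential Q C x + ENNReal.ofReal (η / 3)) ∂σ := by
            refine lintegral_mono_ae ?_
            filter_upwards [hsupp] with x hx
            refine (lintegral_mono_ae (g := fun _ => posPotential Q C x + ENNReal.ofReal (η / 3))
              ?_).trans_eq (by rw [lintegral_const, measure_univ, mul_one])
            filter_upwards [ae_diskMeasure_mem_ball ε] with u hu using hVnear x hx u hu
        _ = _ := by rw [lintegral_add_right _ measurable_const, lintegral_const, measure_univ,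
                      mul_one]
    unfold posEnergy
    have h3 : (3 : ℝ≥0∞) * ENNReal.ofReal (η / 3) = ENNReal.ofReal η := by
      rw [show (3 : ℝ≥0∞) = ENNReal.ofReal 3 by simp, ← ENNReal.ofReal_mul (by norm_num)]
      congr 1; ring
    calc _ ≤ (∫⁻ p, posKernel p.1 p.2 ∂(σ.prod σ) + 2 * ENNReal.ofReal (η / 3))
          + (∫⁻ z, posPotential Q C z ∂σ + ENNReal.ofReal (η / 3)) := by
          refine add_le_add ((lintegral_posKernel_smearedMeasure_le σ hε).trans ?_) hV
          gcongr
      _ = _ := by rw [← h3]; ring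
  · obtain ⟨D, hD⟩ := hcpt.bddAbove_image continuous_growthLog.continuousOn
    have h1 : ∀ᵐ z ∂(smearedMeasure σ ε), z ∈ Metric.cthickening δ σ.support :=
      ae_smearedMeasure σ hε hsupp Metric.isClosed_cthickening.measurableSet hnear
    have h2 : ∀ᵐ z ∂(smearedMeasure σ ε), ENNReal.ofReal (growthLog z) ≤ ENNReal.ofReal D := by
      filter_upwards [h1] with z hz
      exact ENNReal.ofReal_le_ofReal (hD (Set.mem_image_of_mem _ hz))
    refine (lintegral_mono_ae h2).trans_lt ?_
    rw [lintegral_const, measure_univ, mul_one]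
    exact ENNReal.ofReal_lt_top

end Trial

/-! ### Lower bound for the partition function -/

lemma expWeight_coe (β : ℝ) (g : NNReal) :
    expWeight β g = ENNReal.ofReal (Real.exp (-(β * g))) := by
  rw [expWeight, EReal.coe_nnreal_eq_coe_real, ← EReal.coe_mul, ← EReal.coe_neg, EReal.exp_coe]

lemma expWeight_top {β : ℝ} (hβ : 0 < β) : expWeight β ⊤ = 0 := by
  rw [expWeight, EReal.coe_ennreal_top, EReal.coe_mul_top_of_pos hβ, EReal.neg_top, EReal.exp_bot]

lemma expWeight_anti {β : ℝ} (hβ : 0 ≤ β) : Antitone (expWeight β) := fun x y h => by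
  unfold expWeight
  refine EReal.exp_monotone (EReal.neg_le_neg_iff.2 ?_)
  exact mul_le_mul_of_nonneg_left (EReal.coe_ennreal_le_coe_ennreal_iff.2 h) (EReal.coe_nonneg.2 hβ)

lemma measurable_expWeight {β : ℝ} (hβ : 0 ≤ β) : Measurable (expWeight β) :=
  (expWeight_anti hβ).measurable

/-- Jensen's inequality for the Boltzmann factor. -/
lemma expWeight_lintegral_le {Ω : Type*} [MeasurableSpace Ω] (P : Measure Ω)
    [IsProbabilityMeasure P] {G : Ω → ℝ≥0∞} (hG : Measurable G) {β : ℝ} (hβ : 0 < β)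
    {m : NNReal} (hm : ∫⁻ ω, G ω ∂P ≤ m) :
    expWeight β m ≤ ∫⁻ ω, expWeight β (G ω) ∂P := by
  set e : ℝ := Real.exp (-(β * m))
  have he : 0 < e := Real.exp_pos _
  set c : ℝ≥0∞ := ENNReal.ofReal (e * β)
  have hc : c ≠ 0 := (ENNReal.ofReal_pos.2 (by positivity)).ne'
  -- the exponential lies above its tangent line at `m`
  have hpt : ∀ ω, ENNReal.ofReal e + c * m ≤ expWeight β (G ω) + c * G ω := fun ω => by
    induction G ω using ENNReal.recTopCoe with
    | top => rw [ENNReal.mul_top hc, add_top]; exact le_top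
    | coe g =>
      rw [expWeight_coe, ← ENNReal.ofReal_coe_nnreal (p := m), ← ENNReal.ofReal_coe_nnreal (p := g),
        ← ENNReal.ofReal_mul (by positivity), ← ENNReal.ofReal_mul (by positivity),
        ← ENNReal.ofReal_add he.le (by positivity),
        ← ENNReal.ofReal_add (Real.exp_pos _).le (by positivity)]
      refine ENNReal.ofReal_le_ofReal ?_
      have h1 : Real.exp (-(β * g)) = e * Real.exp (β * m - β * g) := by
        rw [← Real.exp_add]; congr 1; ring
      have h2 := Real.add_one_le_exp (β * m - β * g)
      rw [h1]
      nlinarith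
  have h1 : ENNReal.ofReal e + c * m ≤ ∫⁻ ω, expWeight β (G ω) ∂P + c * m := by
    calc ENNReal.ofReal e + c * m = ∫⁻ _, (ENNReal.ofReal e + c * m) ∂P := by
          rw [lintegral_const, measure_univ, mul_one]
      _ ≤ ∫⁻ ω, (expWeight β (G ω) + c * G ω) ∂P := lintegral_mono hpt
      _ = ∫⁻ ω, expWeight β (G ω) ∂P + c * ∫⁻ ω, G ω ∂P := by
          rw [lintegral_add_right _ (hG.const_mul c), lintegral_const_mul _ hG]
      _ ≤ _ := by gcongr
  rw [expWeight_coe]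
  exact (ENNReal.add_le_add_iff_right (ENNReal.mul_ne_top ENNReal.ofReal_ne_top
    ENNReal.coe_ne_top)).1 h1

lemma sigmaFinite_smul {E : Type*} [MeasurableSpace E] (μ : Measure E) [SigmaFinite μ] {M : ℝ≥0∞}
    (hM : M ≠ ⊤) : SigmaFinite (M • μ) := by
  lift M to NNReal using hM
  exact SMul.sigmaFinite M

lemma pi_le_of_le {ι E : Type*} [Fintype ι] [MeasurableSpace E] {ν μ : Measure E} [SigmaFinite ν]
    [SigmaFinite μ] (h : ν ≤ μ) :
    Measure.pi (fun _ : ι => ν) ≤ Measure.pi (fun _ : ι => μ) := by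
  refine Measure.le_iff.2 fun s hs => ?_
  have h1 : (Measure.pi fun _ : ι => ν).toOuterMeasure
      ≤ OuterMeasure.pi fun _ : ι => μ.toOuterMeasure := by
    refine OuterMeasure.le_pi.2 fun t _ => ?_
    change Measure.pi (fun _ : ι => ν) _ ≤ _
    rw [Measure.pi_pi]
    exact Finset.prod_le_prod' fun i _ => h (t i)
  rw [Measure.pi_def fun _ : ι => μ]
  exact (h1 s).trans (le_toMeasure_apply _ _ s)

lemma pi_const_smul {ι E : Type*} [Fintype ι] [MeasurableSpace E] (μ : Measure E) [SigmaFinite μ]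
    {M : ℝ≥0∞} (hM : M ≠ ⊤) :
    Measure.pi (fun _ : ι => M • μ) = M ^ Fintype.card ι • Measure.pi (fun _ : ι => μ) := by
  have : SigmaFinite (M • μ) := sigmaFinite_smul μ hM
  refine Measure.pi_eq fun s _ => ?_
  rw [Measure.smul_apply, Measure.pi_pi, smul_eq_mul]
  simp [Finset.prod_mul_distrib]

instance : SigmaFinite areaMeasure := by
  unfold areaMeasure
  exact sigmaFinite_smul _ (ENNReal.inv_ne_top.2 (ENNReal.ofReal_pos.2 Real.pi_pos).ne')

section Hamiltonian

variable {V : ℂ → ℝ≥0∞}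

lemma measurable_posHamiltonian (hV : Measurable V) (n : ℕ) :
    Measurable (posHamiltonian V n) := by
  have := continuous_growthLog.measurable
  unfold posHamiltonian
  fun_prop

lemma lintegral_pi_pair {n : ℕ} (ν : Measure ℂ) [IsProbabilityMeasure ν] {i j : Fin n}
    (hij : i ≠ j) {f : ℂ × ℂ → ℝ≥0∞} (hf : Measurable f) :
    ∫⁻ ζ, f (ζ i, ζ j) ∂(Measure.pi fun _ : Fin n => ν) = ∫⁻ p, f p ∂(ν.prod ν) := by
  have hind : ProbabilityTheory.iIndepFun (fun (i : Fin n) (ζ : Fin n → ℂ) => ζ i)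
      (Measure.pi fun _ : Fin n => ν) :=
    ProbabilityTheory.iIndepFun_pi (X := fun _ z => z) (fun _ => aemeasurable_id)
  have h := (ProbabilityTheory.indepFun_iff_map_prod_eq_prod_map_map
    (measurable_pi_apply i).aemeasurable (measurable_pi_apply j).aemeasurable).1
    (hind.indepFun hij)
  rw [(measurePreserving_eval (fun _ : Fin n => ν) i).map_eq,
    (measurePreserving_eval (fun _ : Fin n => ν) j).map_eq] at h
  rw [← h, lintegral_map hf (by fun_prop)]

lemma lintegral_pi_eval {n : ℕ} (ν : Measure ℂ) [IsProbabilityMeasure ν] (j : Fin n)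
    {f : ℂ → ℝ≥0∞} (hf : Measurable f) :
    ∫⁻ ζ, f (ζ j) ∂(Measure.pi fun _ : Fin n => ν) = ∫⁻ z, f z ∂ν :=
  (measurePreserving_eval (fun _ : Fin n => ν) j).lintegral_comp hf

/-- The mean of the Hamiltonian under independent points. -/
lemma lintegral_posHamiltonian_pi_le (hV : Measurable V) (ν : Measure ℂ) [IsProbabilityMeasure ν]
    (n : ℕ) :
    ∫⁻ ζ, posHamiltonian V n ζ ∂(Measure.pi fun _ : Fin n => ν)
      ≤ n ^ 2 * posEnergy V ν + 2 * n * ∫⁻ z, ENNReal.ofReal (growthLog z) ∂ν := by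
  have hg := continuous_growthLog.measurable
  unfold posHamiltonian
  rw [lintegral_add_right _ (by fun_prop), lintegral_add_right _ (by fun_prop),
    lintegral_const_mul _ (by fun_prop), lintegral_const_mul _ (by fun_prop),
    lintegral_finsetSum _ (by fun_prop), lintegral_finsetSum _ (by fun_prop),
    lintegral_finsetSum _ (by fun_prop)]
  have h1 : ∀ p ∈ (Finset.univ : Finset (Fin n)).offDiag,
      ∫⁻ ζ, posKernel (ζ p.1) (ζ p.2) ∂(Measure.pi fun _ : Fin n => ν)
        = ∫⁻ q, posKernel q.1 q.2 ∂(ν.prod ν) := fun p hp =>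
    lintegral_pi_pair ν (Finset.mem_offDiag.1 hp).2.2 measurable_posKernel
  rw [Finset.sum_congr rfl h1, Finset.sum_congr rfl fun j _ => lintegral_pi_eval ν j hV,
    Finset.sum_congr rfl fun j _ => lintegral_pi_eval ν j hg.ennreal_ofReal]
  simp only [Finset.sum_const, Finset.card_univ, Fintype.card_fin, nsmul_eq_mul]
  have hcard : (((Finset.univ : Finset (Fin n)).offDiag.card : ℕ) : ℝ≥0∞) ≤ n ^ 2 := by
    rw [Finset.offDiag_card, Finset.card_univ, Fintype.card_fin]
    exact_mod_cast (Nat.sub_le _ _).trans_eq (sq n).symm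
  unfold posEnergy
  calc _ ≤ n ^ 2 * ∫⁻ q, posKernel q.1 q.2 ∂(ν.prod ν) + n * (n * ∫⁻ z, V z ∂ν)
        + 2 * (n * ∫⁻ z, ENNReal.ofReal (growthLog z) ∂ν) := by gcongr
    _ = _ := by ring

end Hamiltonian

/-- The partition function is at least `exp (-β n² (I + η))`, where `I` is the minimal energy. The
loss `M⁻ⁿ` due to the density of the trial measure is negligible because `n β_n → ∞`. -/
lemma eventually_le_lintegral_expWeight {Q : ℂ → EReal} {C : ℝ} {σ : Measure ℂ}
    (hQ : IsExternalPotential Q) [IsProbabilityMeasure σ]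
    (hσ : IsCompact σ.support) (hS : σ.support ⊆ interior (finiteSet Q))
    (hfin : posEnergy (posPotential Q C) σ < ⊤) {β : ℕ → ℝ}
    (hβ : Tendsto (fun n : ℕ => (n : ℝ) * β n) atTop atTop) {η : ℝ} (hη : 0 < η) :
    ∀ᶠ n in atTop, ENNReal.ofReal
        (Real.exp (-(β n * n ^ 2 * ((posEnergy (posPotential Q C) σ).toReal + η))))
      ≤ ∫⁻ ζ, expWeight (β n) (posHamiltonian (posPotential Q C) n ζ)
          ∂(Measure.pi fun _ : Fin n => areaMeasure) := by
  have hVm : Measurable (posPotential Q C) :=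
    (lowerSemicontinuous_posPotential hQ.lowerSemicontinuous C).measurable
  obtain ⟨ν, hν, ⟨M, hM0, hM, hle⟩, hE, hD⟩ :=
    exists_trial_measure hQ C hσ hS (η := η / 2) (by positivity)
  obtain ⟨D, hD'⟩ : ∃ D : NNReal, (D : ℝ≥0∞) = ∫⁻ z, ENNReal.ofReal (growthLog z) ∂ν :=
    ⟨_, ENNReal.coe_toNNReal hD.ne⟩
  obtain ⟨J, hJ⟩ : ∃ J : NNReal, (J : ℝ≥0∞) = posEnergy (posPotential Q C) σ :=
    ⟨_, ENNReal.coe_toNNReal hfin.ne⟩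
  have hMr : 0 < M.toReal := ENNReal.toReal_pos hM0 hM
  -- the errors are of size `β n` and `n`, to be compared with `β n²`
  have hlarge : ∀ᶠ n : ℕ in atTop, Real.log M.toReal ≤ η / 4 * (n * β n) :=
    (hβ.const_mul_atTop (by positivity : 0 < η / 4)).eventually_ge_atTop _
  have hlarge' : ∀ᶠ n : ℕ in atTop, 2 * (D : ℝ) ≤ η / 4 * n :=
    (tendsto_natCast_atTop_atTop.const_mul_atTop (by positivity : 0 < η / 4)).eventually_ge_atTop _
  filter_upwards [hlarge, hlarge', hβ.eventually_gt_atTop 0, eventually_gt_atTop 0]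
    with n h1 h2 h3 h4
  have hn : (0 : ℝ) < n := by exact_mod_cast h4
  have hβn : 0 < β n := by
    rcases pos_and_pos_or_neg_and_neg_of_mul_pos h3 with h | h
    · exact h.2
    · linarith [h.1]
  set G := posHamiltonian (posPotential Q C) n
  set m : NNReal := n ^ 2 * (J + (η / 2).toNNReal) + 2 * n * D
  have hm : ∫⁻ ζ, G ζ ∂(Measure.pi fun _ : Fin n => ν) ≤ m := by
    refine (lintegral_posHamiltonian_pi_le hVm ν n).trans ?_
    simp only [m, ENNReal.coe_add, ENNReal.coe_mul, ENNReal.coe_pow, ENNReal.coe_natCast,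
      ENNReal.coe_ofNat, hJ, hD']
    gcongr
    exact hE
  have hGm : Measurable G := measurable_posHamiltonian hVm n
  have hjen := expWeight_lintegral_le _ hGm hβn hm
  have hpi : Measure.pi (fun _ : Fin n => ν)
      ≤ M ^ n • Measure.pi (fun _ : Fin n => areaMeasure) := by
    have : SigmaFinite (M • areaMeasure) := sigmaFinite_smul _ hM
    refine (pi_le_of_le hle).trans_eq ?_
    rw [pi_const_smul _ hM, Fintype.card_fin]
  have hmain := hjen.trans (lintegral_mono' hpi le_rfl)
  rw [lintegral_smul_measure, smul_eq_mul, expWeight_coe] at hmain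
  have hMn : M ^ n = ENNReal.ofReal (Real.exp (n * Real.log M.toReal)) := by
    rw [Real.exp_nat_mul, Real.exp_log hMr, ENNReal.ofReal_pow hMr.le, ENNReal.ofReal_toReal hM]
  rw [hMn] at hmain
  set Z := ∫⁻ ζ, expWeight (β n) (G ζ) ∂(Measure.pi fun _ : Fin n => areaMeasure)
  calc ENNReal.ofReal (Real.exp (-(β n * n ^ 2 * ((posEnergy (posPotential Q C) σ).toReal + η))))
      ≤ ENNReal.ofReal (Real.exp (-(n * Real.log M.toReal)))
          * ENNReal.ofReal (Real.exp (-(β n * m))) := by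
        rw [← ENNReal.ofReal_mul (Real.exp_pos _).le, ← Real.exp_add, ← hJ, ENNReal.coe_toReal]
        refine ENNReal.ofReal_le_ofReal (Real.exp_le_exp.2 ?_)
        simp only [m, NNReal.coe_add, NNReal.coe_mul, NNReal.coe_pow, NNReal.coe_natCast,
          NNReal.coe_ofNat, Real.coe_toNNReal _ (show 0 ≤ η / 2 by positivity)]
        have e1 := mul_le_mul_of_nonneg_left h1 hn.le
        have e2 := mul_le_mul_of_nonneg_left h2 (mul_pos hβn hn).le
        nlinarith
    _ ≤ ENNReal.ofReal (Real.exp (-(n * Real.log M.toReal)))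
          * (ENNReal.ofReal (Real.exp (n * Real.log M.toReal)) * Z) := by gcongr
    _ = Z := by
        rw [← mul_assoc, ← ENNReal.ofReal_mul (Real.exp_pos _).le, ← Real.exp_add,
          neg_add_cancel, Real.exp_zero, ENNReal.ofReal_one, one_mul]

/-! ### Positive definiteness of Gaussian kernels -/

/-- The mutual energy `∬ exp (-s ‖x - y‖²) dμ(x) dν(y)` with respect to a Gaussian kernel. -/
noncomputable def gaussEnergy (s : ℝ) (μ ν : Measure ℂ) : ℝ :=
  ∫ p, Real.exp (-(s * ‖p.1 - p.2‖ ^ 2)) ∂(μ.prod ν)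

lemma gaussEnergy_nonneg (s : ℝ) (μ ν : Measure ℂ) : 0 ≤ gaussEnergy s μ ν :=
  integral_nonneg fun _ => (Real.exp_pos _).le

section Gauss

open ComplexConjugate

variable (μ ν : Measure ℂ) [IsProbabilityMeasure μ] [IsProbabilityMeasure ν]

lemma integrable_gauss {s : ℝ} (hs : 0 ≤ s) :
    Integrable (fun p : ℂ × ℂ => Real.exp (-(s * ‖p.1 - p.2‖ ^ 2))) (μ.prod ν) := by
  refine Integrable.of_bound (by fun_prop) 1 (ae_of_all _ fun p => ?_)
  rw [Real.norm_eq_abs, Real.abs_exp, Real.exp_le_one_iff]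
  have := mul_nonneg hs (sq_nonneg ‖p.1 - p.2‖)
  linarith

lemma gaussEnergy_comm (s : ℝ) : gaussEnergy s μ ν = gaussEnergy s ν μ := by
  unfold gaussEnergy
  rw [← integral_prod_swap]
  simp only [Prod.fst_swap, Prod.snd_swap, norm_sub_rev]

/-- The Fourier representation of the mutual Gaussian energy. -/
lemma integral_charFun_mul_conj {b : ℝ} (hb : 0 < b) :
    ∫ ξ : ℂ, Complex.exp (-(b : ℂ) * ‖ξ‖ ^ 2) * (charFun μ ξ * conj (charFun ν ξ))
      = ((Real.pi / b : ℝ) : ℂ) * (gaussEnergy (1 / (4 * b)) μ ν : ℂ) := by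
  have hb' : 0 < (b : ℂ).re := by simpa using hb
  set F : ℂ → ℂ × ℂ → ℂ := fun ξ p =>
    Complex.exp (-(b : ℂ) * ‖ξ‖ ^ 2) * Complex.exp ((inner ℝ (p.1 - p.2) ξ : ℝ) * Complex.I)
  have hF : ∀ ξ, Complex.exp (-(b : ℂ) * ‖ξ‖ ^ 2) * (charFun μ ξ * conj (charFun ν ξ))
      = ∫ p, F ξ p ∂(μ.prod ν) := fun ξ => by
    simp only [F]
    rw [integral_const_mul, charFun_apply, charFun_apply, ← integral_conj, ← integral_prod_mul]
    congr 1
    refine integral_congr_ae (ae_of_all _ fun p => ?_)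
    simp only [← Complex.exp_conj, ← Complex.exp_add]
    congr 1
    simp only [map_mul, Complex.conj_ofReal, Complex.conj_I, inner_sub_left]
    push_cast
    ring
  have hg : Integrable (fun ξ : ℂ => Complex.exp (-(b : ℂ) * ‖ξ‖ ^ 2)) := by
    simpa using GaussianFourier.integrable_cexp_neg_mul_sq_norm_add hb' 0 (0 : ℂ)
  have hint : Integrable (Function.uncurry F) (volume.prod (μ.prod ν)) := by
    have h1 : Integrable (fun q : ℂ × (ℂ × ℂ) =>
        Complex.exp (-(b : ℂ) * ‖q.1‖ ^ 2) * (fun _ => (1 : ℂ)) q.2) (volume.prod (μ.prod ν)) :=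
      hg.mul_prod (integrable_const 1)
    refine h1.mono (Continuous.aestronglyMeasurable ?_) (ae_of_all _ fun q => ?_)
    · simp only [F, Function.uncurry_def]
      fun_prop
    · simp only [F, Function.uncurry_def, norm_mul, Complex.norm_exp_ofReal_mul_I, norm_one,
        le_refl]
  simp only [hF]
  rw [integral_integral_swap hint, gaussEnergy, ← integral_complex_ofReal, ← integral_const_mul]
  refine integral_congr_ae (ae_of_all _ fun p => ?_)
  have h := GaussianFourier.integral_cexp_neg_mul_sq_norm_add hb' Complex.I (p.1 - p.2)
  have hcongr : ∀ ξ, F ξ p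
      = Complex.exp (-(b : ℂ) * ‖ξ‖ ^ 2 + Complex.I * (inner ℝ (p.1 - p.2) ξ : ℝ)) := fun ξ => by
    simp only [F]
    rw [← Complex.exp_add, mul_comm Complex.I]
  simp only [hcongr]
  rw [h, Complex.finrank_real_complex]
  have hbc : (b : ℂ) ≠ 0 := by exact_mod_cast hb.ne'
  rw [show (((2 : ℕ) : ℂ) / 2) = 1 by norm_num, Complex.cpow_one]
  push_cast
  congr 2
  rw [Complex.I_sq]
  field_simp

/-- The Gaussian energy of `μ - ν` is a weighted squared `L²` norm of its characteristic function. -/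
lemma integral_gauss_mul_norm_charFun_sub_sq {s : ℝ} (hs : 0 < s) :
    Integrable (fun ξ : ℂ => Real.exp (-(1 / (4 * s)) * ‖ξ‖ ^ 2)
        * ‖charFun μ ξ - charFun ν ξ‖ ^ 2) ∧
    ∫ ξ : ℂ, Real.exp (-(1 / (4 * s)) * ‖ξ‖ ^ 2) * ‖charFun μ ξ - charFun ν ξ‖ ^ 2
      = 4 * Real.pi * s * (gaussEnergy s μ μ + gaussEnergy s ν ν - 2 * gaussEnergy s μ ν) := by
  set b : ℝ := 1 / (4 * s)
  have hb : 0 < b := by positivity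
  have hb' : 0 < (b : ℂ).re := by simpa using hb
  have hg : Integrable (fun ξ : ℂ => Complex.exp (-(b : ℂ) * ‖ξ‖ ^ 2)) := by
    simpa using GaussianFourier.integrable_cexp_neg_mul_sq_norm_add hb' 0 (0 : ℂ)
  have hcont : ∀ (κ : Measure ℂ) [IsProbabilityMeasure κ], Continuous (charFun κ) :=
    fun κ _ => continuous_charFun
  set g : Measure ℂ → Measure ℂ → ℂ → ℂ := fun κ κ' ξ =>
    Complex.exp (-(b : ℂ) * ‖ξ‖ ^ 2) * (charFun κ ξ * conj (charFun κ' ξ))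
  have hi : ∀ (κ κ' : Measure ℂ) [IsProbabilityMeasure κ] [IsProbabilityMeasure κ'],
      Integrable (g κ κ') := fun κ κ' _ _ => by
    have h1 := hcont κ
    have h2 := hcont κ'
    refine hg.mono (Continuous.aestronglyMeasurable (by fun_prop)) (ae_of_all _ fun ξ => ?_)
    rw [norm_mul, norm_mul, RCLike.norm_conj]
    refine mul_le_of_le_one_right (norm_nonneg _) ?_
    exact mul_le_one₀ (norm_charFun_le_one ξ) (norm_nonneg _) (norm_charFun_le_one ξ)
  have hexp : ∀ ξ : ℂ, ((Real.exp (-b * ‖ξ‖ ^ 2) * ‖charFun μ ξ - charFun ν ξ‖ ^ 2 : ℝ) : ℂ)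
      = g μ μ ξ + g ν ν ξ - (g μ ν ξ + g ν μ ξ) := fun ξ => by
    have h1 : ((‖charFun μ ξ - charFun ν ξ‖ ^ 2 : ℝ) : ℂ)
        = (charFun μ ξ - charFun ν ξ) * conj (charFun μ ξ - charFun ν ξ) := by
      rw [Complex.mul_conj, Complex.normSq_eq_norm_sq]
    rw [Complex.ofReal_mul, h1]
    simp only [g, map_sub]
    push_cast
    ring
  have hI1 : Integrable (fun ξ => g μ μ ξ + g ν ν ξ) := (hi μ μ).add (hi ν ν)
  have hI2 : Integrable (fun ξ => g μ ν ξ + g ν μ ξ) := (hi μ ν).add (hi ν μ)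
  have hI' : Integrable (fun ξ : ℂ => ((Real.exp (-b * ‖ξ‖ ^ 2)
      * ‖charFun μ ξ - charFun ν ξ‖ ^ 2 : ℝ) : ℂ)) := by
    simp only [hexp]
    exact hI1.sub hI2
  refine ⟨hI'.re, ?_⟩
  rw [← Complex.ofReal_inj, ← integral_complex_ofReal]
  simp only [hexp]
  rw [integral_sub hI1 hI2, integral_add (hi μ μ) (hi ν ν), integral_add (hi μ ν) (hi ν μ),
    integral_charFun_mul_conj μ μ hb, integral_charFun_mul_conj ν ν hb,
    integral_charFun_mul_conj μ ν hb, integral_charFun_mul_conj ν μ hb, gaussEnergy_comm ν μ,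
    show 1 / (4 * b) = s by simp only [b]; field_simp,
    show Real.pi / b = 4 * Real.pi * s by simp only [b]; field_simp]
  push_cast
  ring

lemma two_mul_gaussEnergy_le {s : ℝ} (hs : 0 < s) :
    2 * gaussEnergy s μ ν ≤ gaussEnergy s μ μ + gaussEnergy s ν ν := by
  have h := (integral_gauss_mul_norm_charFun_sub_sq μ ν hs).2
  have h0 : 0 ≤ 4 * Real.pi * s *
      (gaussEnergy s μ μ + gaussEnergy s ν ν - 2 * gaussEnergy s μ ν) := by
    rw [← h]
    exact integral_nonneg fun ξ => by positivity
  have := nonneg_of_mul_nonneg_right h0 (by positivity)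
  linarith

lemma eq_of_two_mul_gaussEnergy_eq {s : ℝ} (hs : 0 < s)
    (h : 2 * gaussEnergy s μ ν = gaussEnergy s μ μ + gaussEnergy s ν ν) : μ = ν := by
  obtain ⟨hi, he⟩ := integral_gauss_mul_norm_charFun_sub_sq μ ν hs
  rw [show gaussEnergy s μ μ + gaussEnergy s ν ν - 2 * gaussEnergy s μ ν = 0 by linarith,
    mul_zero, integral_eq_zero_iff_of_nonneg (fun ξ => by positivity) hi] at he
  have hae : charFun μ =ᵐ[volume] charFun ν := by
    filter_upwards [he] with ξ hξ
    have h1 : ‖charFun μ ξ - charFun ν ξ‖ ^ 2 = 0 := by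
      simpa [Real.exp_ne_zero] using hξ
    simpa [sub_eq_zero] using h1
  exact Measure.ext_of_charFun
    ((Continuous.ae_eq_iff_eq volume continuous_charFun continuous_charFun).1 hae)

lemma gaussEnergy_le_one {s : ℝ} (hs : 0 ≤ s) : gaussEnergy s μ ν ≤ 1 := by
  have h := integral_mono (integrable_gauss μ ν hs) (integrable_const (1 : ℝ)) fun p => by
    have := mul_nonneg hs (sq_nonneg ‖p.1 - p.2‖)
    exact Real.exp_le_one_iff.2 (by linarith)
  rwa [integral_const, probReal_univ, one_smul] at h

end Gauss

/-! ### The logarithm as a superposition of Gaussians -/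

/-- The short-range part `∫_1^∞ exp (-s t) ds / s` of the kernel `log (1 / t)`. -/
noncomputable def shortRange (t : ℝ) : ℝ≥0∞ :=
  ∫⁻ s in Set.Ioi (1 : ℝ), ENNReal.ofReal (Real.exp (-(s * t)) / s)

/-- The long-range part `∫_0^1 (1 - exp (-s t)) ds / s` of the kernel `log t`. -/
noncomputable def longRange (t : ℝ) : ℝ≥0∞ :=
  ∫⁻ s in Set.Ioc (0 : ℝ) 1, ENNReal.ofReal ((1 - Real.exp (-(s * t))) / s)

lemma integrableOn_exp_neg_div {t : ℝ} (ht : 0 < t) :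
    IntegrableOn (fun u => Real.exp (-u) / u) (Set.Ioi t) := by
  have h := (exp_neg_integrableOn_Ioi t zero_lt_one).div_const t
  refine h.mono' (Measurable.aestronglyMeasurable (by fun_prop)) ?_
  filter_upwards [ae_restrict_mem measurableSet_Ioi] with u hu
  have hu : t < u := hu
  rw [Real.norm_of_nonneg (div_nonneg (Real.exp_pos _).le (ht.trans hu).le), neg_one_mul]
  gcongr

lemma shortRange_eq {t : ℝ} (ht : 0 < t) :
    shortRange t = ENNReal.ofReal (∫ u in Set.Ioi t, Real.exp (-u) / u) := by
  have hcomp := integral_comp_mul_left_Ioi (fun u => Real.exp (-u) / u) 1 ht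
  have hci : IntegrableOn (fun s => Real.exp (-(t * s)) / (t * s)) (Set.Ioi 1) :=
    (integrableOn_Ioi_comp_mul_left_iff (fun u => Real.exp (-u) / u) 1 ht).2
      (by rw [mul_one]; exact integrableOn_exp_neg_div ht)
  have heq : ∀ s, Real.exp (-(s * t)) / s = t * (Real.exp (-(t * s)) / (t * s)) := fun s => by
    rw [mul_comm s t]; field_simp
  have hfi : IntegrableOn (fun s => Real.exp (-(s * t)) / s) (Set.Ioi 1) := by
    simp only [heq]
    exact hci.const_mul t
  rw [shortRange, ← ofReal_integral_eq_lintegral_ofReal hfi]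
  · simp only [heq]
    rw [integral_const_mul, hcomp, mul_one, smul_eq_mul, mul_inv_cancel_left₀ ht.ne']
  · filter_upwards [ae_restrict_mem measurableSet_Ioi] with s hs
    have hs : (1 : ℝ) < s := hs
    simp only [Pi.zero_apply]
    positivity

lemma intervalIntegrable_one_sub_exp_div (a b : ℝ) :
    IntervalIntegrable (fun u => (1 - Real.exp (-u)) / u) volume a b := by
  have hm : Measurable fun u : ℝ => (1 - Real.exp (-u)) / u := by fun_prop
  have hc : IntervalIntegrable (fun u : ℝ => 1 + Real.exp (-u)) volume a b :=
    Continuous.intervalIntegrable (by fun_prop) a b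
  refine hc.mono_fun hm.aestronglyMeasurable (ae_of_all _ fun u => ?_)
  have h1 := Real.add_one_le_exp (-u)
  have h2 := Real.add_one_le_exp u
  have h3 : Real.exp u * Real.exp (-u) = 1 := by rw [← Real.exp_add, add_neg_cancel, Real.exp_zero]
  have h4 := Real.exp_pos (-u)
  dsimp only
  rw [Real.norm_of_nonneg (by positivity : 0 ≤ 1 + Real.exp (-u)), norm_div, Real.norm_eq_abs,
    Real.norm_eq_abs]
  rcases eq_or_ne u 0 with rfl | hu
  · simp
  rw [div_le_iff₀ (abs_pos.2 hu)]
  rcases le_total 0 u with h | h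
  · rw [abs_of_nonneg (by nlinarith), abs_of_nonneg h]
    nlinarith
  · rw [abs_of_nonpos (by nlinarith), abs_of_nonpos h]
    nlinarith

lemma longRange_eq {t : ℝ} (ht : 0 < t) :
    longRange t = ENNReal.ofReal (∫ u in (0 : ℝ)..t, (1 - Real.exp (-u)) / u) := by
  have hcomp := intervalIntegral.integral_comp_mul_left (a := 0) (b := 1)
    (fun u => (1 - Real.exp (-u)) / u) ht.ne'
  have hci : IntervalIntegrable (fun s => (1 - Real.exp (-(t * s))) / (t * s)) volume 0 1 := by
    have := (intervalIntegrable_one_sub_exp_div 0 t).comp_mul_left (c := t)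
    simpa [ht.ne'] using this
  have heq : ∀ s, (1 - Real.exp (-(s * t))) / s = t * ((1 - Real.exp (-(t * s))) / (t * s)) :=
    fun s => by rw [mul_comm s t]; field_simp
  have hfi : IntegrableOn (fun s => (1 - Real.exp (-(s * t))) / s) (Set.Ioc 0 1) := by
    simp only [heq]
    exact ((intervalIntegrable_iff_integrableOn_Ioc_of_le zero_le_one).1 hci).const_mul t
  rw [longRange, ← ofReal_integral_eq_lintegral_ofReal hfi]
  · rw [← intervalIntegral.integral_of_le zero_le_one]
    simp only [heq]
    rw [intervalIntegral.integral_const_mul, hcomp, mul_one, mul_zero, smul_eq_mul,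
      mul_inv_cancel_left₀ ht.ne']
  · filter_upwards [ae_restrict_mem measurableSet_Ioc] with s hs
    have h1 : Real.exp (-(s * t)) ≤ 1 := Real.exp_le_one_iff.2 (by nlinarith [hs.1])
    exact div_nonneg (by linarith) hs.1.le

lemma shortRange_zero : shortRange 0 = ⊤ := by
  by_contra h
  refine not_integrableOn_Ioi_inv (a := 1) ⟨by fun_prop, ?_⟩
  have h1 : ∀ s : ℝ, Real.exp (-(s * 0)) / s = s⁻¹ := fun s => by simp
  simp only [shortRange, h1] at h
  refine lt_of_le_of_lt (le_of_eq ?_) (lt_top_iff_ne_top.2 h)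
  refine setLIntegral_congr_fun measurableSet_Ioi fun s hs => ?_
  have hs : (1 : ℝ) < s := hs
  rw [Real.enorm_of_nonneg (by positivity)]

/-- The splitting `log (1 / t) = A(t) - B(t) - A(1) + B(1)` into short-range and long-range part,
which follows from `∫ ds / s` being invariant under scaling. -/
lemma log_eq_shortRange_longRange {t : ℝ} (ht : 0 < t) :
    (∫ u in Set.Ioi t, Real.exp (-u) / u) - (∫ u in (0 : ℝ)..t, (1 - Real.exp (-u)) / u)
      + Real.log t = (∫ u in Set.Ioi (1 : ℝ), Real.exp (-u) / u)
        - ∫ u in (0 : ℝ)..1, (1 - Real.exp (-u)) / u := by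
  have h0 : (0 : ℝ) ∉ Set.uIcc t 1 := Set.notMem_uIcc_of_lt ht zero_lt_one
  have h1 := intervalIntegral.integral_interval_add_Ioi (integrableOn_exp_neg_div ht)
    (integrableOn_exp_neg_div zero_lt_one)
  have h2 := intervalIntegral.integral_add_adjacent_intervals
    (intervalIntegrable_one_sub_exp_div 0 t) (intervalIntegrable_one_sub_exp_div t 1)
  have hi : IntervalIntegrable (fun u => Real.exp (-u) / u) volume t 1 := by
    refine ContinuousOn.intervalIntegrable (ContinuousOn.div (by fun_prop) (by fun_prop) ?_)
    rintro u hu rfl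
    exact h0 hu
  have h3 := intervalIntegral.integral_add hi (intervalIntegrable_one_sub_exp_div t 1)
  have h4 := integral_one_div h0
  rw [one_div, Real.log_inv] at h4
  have h5 : ∫ u in t..1, (Real.exp (-u) / u + (1 - Real.exp (-u)) / u) = ∫ u in t..1, 1 / u := by
    congr 1
    ext u
    ring
  rw [h5, h4] at h3
  linarith

lemma shortRange_one_ne_top : shortRange 1 ≠ ⊤ := by
  rw [shortRange_eq zero_lt_one]; exact ENNReal.ofReal_ne_top

lemma longRange_one_ne_top : longRange 1 ≠ ⊤ := by
  rw [longRange_eq zero_lt_one]; exact ENNReal.ofReal_ne_top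

/-- The splitting of the kernel, with all terms nonnegative. -/
lemma two_mul_posKernel_add (x y : ℂ) :
    2 * posKernel x y + longRange (‖x - y‖ ^ 2) + shortRange 1
      = shortRange (‖x - y‖ ^ 2) + longRange 1
        + 2 * (ENNReal.ofReal (growthLog x) + ENNReal.ofReal (growthLog y)) := by
  rcases eq_or_ne x y with rfl | h
  · simp [posKernel_self, shortRange_zero]
  have hd : 0 < ‖x - y‖ := norm_pos_iff.2 (sub_ne_zero.2 h)
  have ht : 0 < ‖x - y‖ ^ 2 := by positivity
  have hlog := log_eq_shortRange_longRange ht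
  rw [Real.log_pow] at hlog
  have hA : ∀ t : ℝ, 0 < t → 0 ≤ ∫ u in Set.Ioi t, Real.exp (-u) / u := fun t ht =>
    setIntegral_nonneg measurableSet_Ioi fun u hu =>
      div_nonneg (Real.exp_pos _).le (ht.trans hu).le
  have hB : ∀ t : ℝ, 0 < t → 0 ≤ ∫ u in (0 : ℝ)..t, (1 - Real.exp (-u)) / u := fun t ht =>
    intervalIntegral.integral_nonneg ht.le fun u hu =>
      div_nonneg (by have := Real.exp_le_one_iff.2 (neg_nonpos.2 hu.1); linarith) hu.1
  have hA1 := hA _ ht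
  have hA2 := hA 1 zero_lt_one
  have hB1 := hB _ ht
  have hB2 := hB 1 zero_lt_one
  have hx := growthLog_nonneg x
  have hy := growthLog_nonneg y
  have hk := log_norm_sub_le x y
  rw [posKernel_of_ne h, shortRange_eq ht, shortRange_eq zero_lt_one, longRange_eq ht,
    longRange_eq zero_lt_one, show (2 : ℝ≥0∞) = ENNReal.ofReal 2 by simp,
    ← ENNReal.ofReal_add hx hy, ← ENNReal.ofReal_mul zero_le_two, ← ENNReal.ofReal_mul zero_le_two,
    ← ENNReal.ofReal_add (by linarith) hB1, ← ENNReal.ofReal_add (by linarith) hA2,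
    ← ENNReal.ofReal_add hA1 hB2, ← ENNReal.ofReal_add (by linarith) (by linarith)]
  congr 1
  push_cast at hlog
  linarith

lemma shortRange_anti : Antitone shortRange := fun t t' h => by
  refine setLIntegral_mono' measurableSet_Ioi fun s hs => ENNReal.ofReal_le_ofReal ?_
  have hs : (1 : ℝ) < s := hs
  gcongr

lemma longRange_mono : Monotone longRange := fun t t' h => by
  refine setLIntegral_mono' measurableSet_Ioc fun s hs => ENNReal.ofReal_le_ofReal ?_
  have hs : 0 < s := hs.1
  gcongr

lemma longRange_le (x y : ℂ) : longRange (‖x - y‖ ^ 2)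
    ≤ longRange 1 + 2 * (ENNReal.ofReal (growthLog x) + ENNReal.ofReal (growthLog y)) := by
  rcases le_total (‖x - y‖ ^ 2) 1 with h | h
  · exact (longRange_mono h).trans le_self_add
  · have h1 := two_mul_posKernel_add x y
    have h2 : longRange (‖x - y‖ ^ 2) + shortRange 1 ≤ (longRange 1
        + 2 * (ENNReal.ofReal (growthLog x) + ENNReal.ofReal (growthLog y))) + shortRange 1 := by
      calc longRange (‖x - y‖ ^ 2) + shortRange 1
          ≤ 2 * posKernel x y + longRange (‖x - y‖ ^ 2) + shortRange 1 := by
            rw [add_assoc]; exact le_add_self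
        _ = _ := h1
        _ ≤ shortRange 1 + longRange 1
            + 2 * (ENNReal.ofReal (growthLog x) + ENNReal.ofReal (growthLog y)) := by
            gcongr
            exact shortRange_anti h
        _ = _ := by ring
    exact (ENNReal.add_le_add_iff_right shortRange_one_ne_top).1 h2

/-! ### Uniqueness of the minimizer -/

lemma measurable_gaussEnergy (μ ν : Measure ℂ) [SFinite μ] [SFinite ν] :
    Measurable fun s => gaussEnergy s μ ν := by
  unfold gaussEnergy
  refine (StronglyMeasurable.integral_prod_right ?_).measurable
  exact Continuous.stronglyMeasurable (by fun_prop)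

section Mutual

variable (μ ν : Measure ℂ) [IsProbabilityMeasure μ] [IsProbabilityMeasure ν]

lemma lintegral_ofReal_gauss {s : ℝ} (hs : 0 ≤ s) (c : ℝ) (hc : 0 ≤ c) :
    ∫⁻ p, ENNReal.ofReal (c * Real.exp (-(s * ‖p.1 - p.2‖ ^ 2))) ∂(μ.prod ν)
      = ENNReal.ofReal (c * gaussEnergy s μ ν) := by
  rw [← ofReal_integral_eq_lintegral_ofReal ((integrable_gauss μ ν hs).const_mul c)
    (ae_of_all _ fun p => by positivity), integral_const_mul, gaussEnergy]

lemma lintegral_shortRange :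
    ∫⁻ p, shortRange (‖p.1 - p.2‖ ^ 2) ∂(μ.prod ν)
      = ∫⁻ s in Set.Ioi (1 : ℝ), ENNReal.ofReal (s⁻¹ * gaussEnergy s μ ν) := by
  unfold shortRange
  rw [lintegral_lintegral_swap (Measurable.aemeasurable (by fun_prop))]
  refine setLIntegral_congr_fun measurableSet_Ioi fun s hs => ?_
  have hs : (1 : ℝ) < s := hs
  simp only [div_eq_inv_mul]
  exact lintegral_ofReal_gauss μ ν (by linarith) _ (by positivity)

lemma lintegral_longRange :
    ∫⁻ p, longRange (‖p.1 - p.2‖ ^ 2) ∂(μ.prod ν)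
      = ∫⁻ s in Set.Ioc (0 : ℝ) 1, ENNReal.ofReal (s⁻¹ * (1 - gaussEnergy s μ ν)) := by
  unfold longRange
  rw [lintegral_lintegral_swap (Measurable.aemeasurable (by fun_prop))]
  refine setLIntegral_congr_fun measurableSet_Ioc fun s hs => ?_
  have hs : 0 < s := hs.1
  have hg := integrable_gauss μ ν hs.le
  have hg' : Integrable (fun p : ℂ × ℂ => 1 - Real.exp (-(s * ‖p.1 - p.2‖ ^ 2))) (μ.prod ν) :=
    (integrable_const 1).sub hg
  simp only [div_eq_inv_mul]
  rw [← ofReal_integral_eq_lintegral_ofReal (hg'.const_mul _),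
    integral_const_mul, integral_sub (integrable_const 1) hg, integral_const, probReal_univ,
    one_smul, gaussEnergy]
  refine ae_of_all _ fun p => mul_nonneg (inv_nonneg.2 hs.le) ?_
  have := Real.exp_le_one_iff.2 (neg_nonpos.2 (mul_nonneg hs.le (sq_nonneg ‖p.1 - p.2‖)))
  linarith

lemma measurable_shortRange : Measurable shortRange := shortRange_anti.measurable

lemma measurable_longRange : Measurable longRange := longRange_mono.measurable

/-- The mean of `log (1 + ‖z‖)`. -/
noncomputable def logMoment (μ : Measure ℂ) : ℝ≥0∞ := ∫⁻ z, ENNReal.ofReal (growthLog z) ∂μ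

lemma lintegral_prod_growthLog :
    ∫⁻ p, (ENNReal.ofReal (growthLog p.1) + ENNReal.ofReal (growthLog p.2)) ∂(μ.prod ν)
      = logMoment μ + logMoment ν := by
  have hg := continuous_growthLog.measurable
  rw [lintegral_add_left (by fun_prop), logMoment, logMoment,
    ← (measurePreserving_fst (μ := μ) (ν := ν)).lintegral_comp hg.ennreal_ofReal,
    ← (measurePreserving_snd (μ := μ) (ν := ν)).lintegral_comp hg.ennreal_ofReal]

/-- The splitting of the mutual logarithmic energy into short-range and long-range part. -/
lemma two_mul_lintegral_posKernel_add :
    2 * ∫⁻ p, posKernel p.1 p.2 ∂(μ.prod ν) + ∫⁻ p, longRange (‖p.1 - p.2‖ ^ 2) ∂(μ.prod ν)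
        + shortRange 1
      = ∫⁻ p, shortRange (‖p.1 - p.2‖ ^ 2) ∂(μ.prod ν) + longRange 1
        + 2 * (logMoment μ + logMoment ν) := by
  have hg := continuous_growthLog.measurable
  have hk := measurable_posKernel
  have hS : Measurable fun p : ℂ × ℂ => shortRange (‖p.1 - p.2‖ ^ 2) :=
    measurable_shortRange.comp (by fun_prop)
  have hL : Measurable fun p : ℂ × ℂ => longRange (‖p.1 - p.2‖ ^ 2) :=
    measurable_longRange.comp (by fun_prop)
  have h := lintegral_congr (μ := μ.prod ν) fun p : ℂ × ℂ => two_mul_posKernel_add p.1 p.2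
  rw [lintegral_add_right _ measurable_const, lintegral_add_right _ hL,
    lintegral_const_mul _ hk, lintegral_add_right _ (by fun_prop),
    lintegral_add_right _ measurable_const, lintegral_const_mul _ (by fun_prop),
    lintegral_prod_growthLog] at h
  simpa using h

lemma lintegral_longRange_le : ∫⁻ p, longRange (‖p.1 - p.2‖ ^ 2) ∂(μ.prod ν)
    ≤ longRange 1 + 2 * (logMoment μ + logMoment ν) := by
  have hg := continuous_growthLog.measurable
  have h : ∀ p : ℂ × ℂ, longRange (‖p.1 - p.2‖ ^ 2) ≤ longRange 1
      + 2 * (ENNReal.ofReal (growthLog p.1) + ENNReal.ofReal (growthLog p.2)) :=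
    fun p => longRange_le p.1 p.2
  refine (lintegral_mono h).trans_eq ?_
  rw [lintegral_add_left measurable_const, lintegral_const_mul _ (by fun_prop),
    lintegral_prod_growthLog]
  simp

/-- The long-range parts are conditionally negative definite. -/
lemma lintegral_longRange_add_le :
    ∫⁻ p, longRange (‖p.1 - p.2‖ ^ 2) ∂(μ.prod μ) + ∫⁻ p, longRange (‖p.1 - p.2‖ ^ 2) ∂(ν.prod ν)
      ≤ 2 * ∫⁻ p, longRange (‖p.1 - p.2‖ ^ 2) ∂(μ.prod ν) := by
  have h1 := measurable_gaussEnergy μ μ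
  have h2 := measurable_gaussEnergy μ ν
  rw [lintegral_longRange, lintegral_longRange, lintegral_longRange,
    ← lintegral_const_mul _ (by fun_prop), ← lintegral_add_left (by fun_prop)]
  refine setLIntegral_mono' measurableSet_Ioc fun s hs => ?_
  have hs : 0 < s := hs.1
  have e1 := gaussEnergy_le_one μ μ hs.le
  have e2 := gaussEnergy_le_one ν ν hs.le
  have e3 := two_mul_gaussEnergy_le μ ν hs
  have hs' : 0 ≤ s⁻¹ := by positivity
  rw [show (2 : ℝ≥0∞) = ENNReal.ofReal 2 by simp, ← ENNReal.ofReal_mul zero_le_two,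
    ← ENNReal.ofReal_add (mul_nonneg hs' (by linarith)) (mul_nonneg hs' (by linarith))]
  refine ENNReal.ofReal_le_ofReal ?_
  nlinarith

end Mutual

/-- Strict positive definiteness of the logarithmic energy on differences of probability measures:
if the mutual energy of `μ` and `ν` is at least the mean of their energies, then `μ = ν`. -/
lemma eq_of_le_mutual_energy {μ ν : Measure ℂ} [IsProbabilityMeasure μ] [IsProbabilityMeasure ν]
    (hμ : logMoment μ ≠ ⊤) (hν : logMoment ν ≠ ⊤)
    (hμk : ∫⁻ p, posKernel p.1 p.2 ∂(μ.prod μ) ≠ ⊤)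
    (hνk : ∫⁻ p, posKernel p.1 p.2 ∂(ν.prod ν) ≠ ⊤)
    (h : ∫⁻ p, posKernel p.1 p.2 ∂(μ.prod μ) + ∫⁻ p, posKernel p.1 p.2 ∂(ν.prod ν)
      ≤ 2 * ∫⁻ p, posKernel p.1 p.2 ∂(μ.prod ν)) : μ = ν := by
  have eμ := two_mul_lintegral_posKernel_add μ μ
  have eν := two_mul_lintegral_posKernel_add ν ν
  have eμν := two_mul_lintegral_posKernel_add μ ν
  have hL := lintegral_longRange_add_le μ ν
  have hfin : ∀ κ : Measure ℂ, IsProbabilityMeasure κ → logMoment κ ≠ ⊤ →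
      ∫⁻ p, posKernel p.1 p.2 ∂(κ.prod κ) ≠ ⊤ →
      ∫⁻ p, shortRange (‖p.1 - p.2‖ ^ 2) ∂(κ.prod κ) ≠ ⊤ := fun κ _ h1 h2 => by
    have hl : ∫⁻ p, longRange (‖p.1 - p.2‖ ^ 2) ∂(κ.prod κ) ≠ ⊤ := by
      refine ne_top_of_le_ne_top ?_ (lintegral_longRange_le κ κ)
      finiteness [longRange_one_ne_top]
    refine ne_top_of_le_ne_top ?_ (le_self_add.trans (le_self_add.trans_eq
      (two_mul_lintegral_posKernel_add κ κ).symm))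
    finiteness [shortRange_one_ne_top]
  have fμ := hfin μ inferInstance hμ hμk
  have fν := hfin ν inferInstance hν hνk
  have hS : ∫⁻ p, shortRange (‖p.1 - p.2‖ ^ 2) ∂(μ.prod μ)
      + ∫⁻ p, shortRange (‖p.1 - p.2‖ ^ 2) ∂(ν.prod ν)
      ≤ 2 * ∫⁻ p, shortRange (‖p.1 - p.2‖ ^ 2) ∂(μ.prod ν) := by
    have hcancel : 2 * longRange 1 + 4 * (logMoment μ + logMoment ν) ≠ ⊤ := by
      finiteness [longRange_one_ne_top]
    refine (ENNReal.add_le_add_iff_right hcancel).1 ?_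
    calc _ = (∫⁻ p, shortRange (‖p.1 - p.2‖ ^ 2) ∂(μ.prod μ) + longRange 1
            + 2 * (logMoment μ + logMoment μ))
          + (∫⁻ p, shortRange (‖p.1 - p.2‖ ^ 2) ∂(ν.prod ν) + longRange 1
            + 2 * (logMoment ν + logMoment ν)) := by ring
      _ = 2 * (∫⁻ p, posKernel p.1 p.2 ∂(μ.prod μ) + ∫⁻ p, posKernel p.1 p.2 ∂(ν.prod ν))
          + (∫⁻ p, longRange (‖p.1 - p.2‖ ^ 2) ∂(μ.prod μ)
            + ∫⁻ p, longRange (‖p.1 - p.2‖ ^ 2) ∂(ν.prod ν)) + 2 * shortRange 1 := by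
          rw [← eμ, ← eν]; ring
      _ ≤ 2 * (2 * ∫⁻ p, posKernel p.1 p.2 ∂(μ.prod ν))
          + 2 * ∫⁻ p, longRange (‖p.1 - p.2‖ ^ 2) ∂(μ.prod ν) + 2 * shortRange 1 := by gcongr
      _ = 2 * (∫⁻ p, shortRange (‖p.1 - p.2‖ ^ 2) ∂(μ.prod ν) + longRange 1
            + 2 * (logMoment μ + logMoment ν)) := by rw [← eμν]; ring
      _ = _ := by ring
  have m1 := measurable_gaussEnergy μ μ
  have m2 := measurable_gaussEnergy ν ν
  have m3 := measurable_gaussEnergy μ ν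
  rw [lintegral_shortRange, lintegral_shortRange, lintegral_shortRange,
    ← lintegral_const_mul _ (by fun_prop), ← lintegral_add_left (by fun_prop)] at hS
  rw [lintegral_shortRange] at fμ fν
  have hle : (fun s => 2 * ENNReal.ofReal (s⁻¹ * gaussEnergy s μ ν))
      ≤ᵐ[volume.restrict (Set.Ioi (1 : ℝ))] fun s =>
        ENNReal.ofReal (s⁻¹ * gaussEnergy s μ μ) + ENNReal.ofReal (s⁻¹ * gaussEnergy s ν ν) := by
    filter_upwards [ae_restrict_mem measurableSet_Ioi] with s hs
    have hs : (1 : ℝ) < s := hs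
    have hs' : 0 < s⁻¹ := by positivity
    have e1 := gaussEnergy_nonneg s μ μ
    have e2 := gaussEnergy_nonneg s ν ν
    rw [show (2 : ℝ≥0∞) = ENNReal.ofReal 2 by simp, ← ENNReal.ofReal_mul zero_le_two,
      ← ENNReal.ofReal_add (by positivity) (by positivity)]
    refine ENNReal.ofReal_le_ofReal ?_
    have := two_mul_gaussEnergy_le μ ν (by linarith : 0 < s)
    nlinarith
  have hne : ∫⁻ s in Set.Ioi (1 : ℝ), 2 * ENNReal.ofReal (s⁻¹ * gaussEnergy s μ ν) ≠ ⊤ := by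
    refine ne_top_of_le_ne_top ?_ (lintegral_mono_ae hle)
    rw [lintegral_add_left (by fun_prop)]
    exact ENNReal.add_ne_top.2 ⟨fμ, fν⟩
  have hae := ae_eq_of_ae_le_of_lintegral_le hle hne (by fun_prop) hS
  have hnull : volume (Set.Ioi (1 : ℝ)) ≠ 0 := by simp
  have : (ae (volume.restrict (Set.Ioi (1 : ℝ)))).NeBot :=
    ae_neBot.2 (by rwa [Ne, Measure.restrict_eq_zero])
  obtain ⟨s, hs, hs1⟩ := (hae.and (ae_restrict_mem measurableSet_Ioi)).exists
  have hs1 : (1 : ℝ) < s := hs1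
  have hs' : 0 < s⁻¹ := by positivity
  have e1 := gaussEnergy_nonneg s μ μ
  have e2 := gaussEnergy_nonneg s ν ν
  have e3 := gaussEnergy_nonneg s μ ν
  dsimp only at hs
  rw [show (2 : ℝ≥0∞) = ENNReal.ofReal 2 by simp, ← ENNReal.ofReal_mul zero_le_two,
    ← ENNReal.ofReal_add (by positivity) (by positivity),
    ENNReal.ofReal_eq_ofReal_iff (by positivity) (by positivity)] at hs
  refine eq_of_two_mul_gaussEnergy_eq μ ν (by linarith : 0 < s) ?_
  refine mul_left_cancel₀ hs'.ne' ?_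
  linarith

section Unique

variable {V : ℂ → ℝ≥0∞} {a : ℝ}

lemma logMoment_le (ha : 0 < a) (hV : ∀ z, ENNReal.ofReal (2 * a * growthLog z) ≤ V z)
    (μ : Measure ℂ) : ENNReal.ofReal (2 * a) * logMoment μ ≤ ∫⁻ z, V z ∂μ := by
  have hg := continuous_growthLog.measurable
  rw [logMoment, ← lintegral_const_mul _ (by fun_prop)]
  refine lintegral_mono fun z => ?_
  rw [← ENNReal.ofReal_mul (by positivity)]
  exact hV z

lemma logMoment_ne_top (ha : 0 < a) (hV : ∀ z, ENNReal.ofReal (2 * a * growthLog z) ≤ V z)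
    {μ : Measure ℂ} (hμ : posEnergy V μ ≠ ⊤) : logMoment μ ≠ ⊤ := by
  intro h
  have h1 := (logMoment_le ha hV μ).trans (le_add_self : _ ≤ posEnergy V μ)
  rw [h, ENNReal.mul_top (ENNReal.ofReal_pos.2 (by positivity)).ne'] at h1
  exact hμ (top_le_iff.1 h1)

/-- The minimizer is unique, because the energy is strictly convex. -/
lemma eq_of_posEnergy_le (ha : 0 < a)
    (hV : ∀ z, ENNReal.ofReal (2 * a * growthLog z) ≤ V z) {σ μ : Measure ℂ}
    [IsProbabilityMeasure σ] [IsProbabilityMeasure μ] (hσ : posEnergy V σ ≠ ⊤)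
    (hmin : ∀ ν : Measure ℂ, IsProbabilityMeasure ν → posEnergy V σ ≤ posEnergy V ν)
    (h : posEnergy V μ ≤ posEnergy V σ) : μ = σ := by
  have hμ : posEnergy V μ ≠ ⊤ := ne_top_of_le_ne_top hσ h
  have hσ' := ENNReal.add_ne_top.1 hσ
  have hμ' := ENNReal.add_ne_top.1 hμ
  refine eq_of_le_mutual_energy (logMoment_ne_top ha hV hμ) (logMoment_ne_top ha hV hσ)
    hμ'.1 hσ'.1 ?_
  set ρ : Measure ℂ := (2 : ℝ≥0∞)⁻¹ • (μ + σ)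
  have hρ : IsProbabilityMeasure ρ := ⟨by
    simp only [ρ, Measure.smul_apply, Measure.add_apply, measure_univ, smul_eq_mul]
    rw [one_add_one_eq_two, ENNReal.inv_mul_cancel two_ne_zero ENNReal.ofNat_ne_top]⟩
  have h1 := hmin ρ hρ
  have hk := measurable_posKernel
  have hsymm : ∫⁻ p, posKernel p.1 p.2 ∂(σ.prod μ) = ∫⁻ p, posKernel p.1 p.2 ∂(μ.prod σ) := by
    rw [← Measure.prod_swap, lintegral_map hk measurable_swap]
    simp only [Prod.fst_swap, Prod.snd_swap, posKernel_comm]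
  have h4 : 4 * posEnergy V ρ = ∫⁻ p, posKernel p.1 p.2 ∂(μ.prod μ)
      + ∫⁻ p, posKernel p.1 p.2 ∂(σ.prod σ) + 2 * ∫⁻ p, posKernel p.1 p.2 ∂(μ.prod σ)
      + 2 * (∫⁻ z, V z ∂μ + ∫⁻ z, V z ∂σ) := by
    have hprod : ρ.prod ρ = ((2 : ℝ≥0∞)⁻¹ * 2⁻¹) • ((μ + σ).prod (μ + σ)) := by
      simp only [ρ]
      rw [Measure.prod_smul_left, Measure.prod_smul_right, smul_smul]
    have e4 : (4 : ℝ≥0∞) * (2⁻¹ * 2⁻¹) = 1 := by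
      rw [show (4 : ℝ≥0∞) = 2 * 2 by norm_num, mul_mul_mul_comm,
        ENNReal.mul_inv_cancel two_ne_zero ENNReal.ofNat_ne_top, one_mul]
    have e2 : (4 : ℝ≥0∞) * 2⁻¹ = 2 := by
      rw [show (4 : ℝ≥0∞) = 2 * 2 by norm_num, mul_assoc,
        ENNReal.mul_inv_cancel two_ne_zero ENNReal.ofNat_ne_top, mul_one]
    unfold posEnergy
    rw [hprod, lintegral_smul_measure, lintegral_smul_measure, smul_eq_mul, smul_eq_mul, mul_add,
      ← mul_assoc (4 : ℝ≥0∞) (2⁻¹ * 2⁻¹), e4, ← mul_assoc (4 : ℝ≥0∞) 2⁻¹, e2, one_mul,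
      lintegral_add_measure, Measure.add_prod,
      Measure.prod_add, Measure.prod_add, lintegral_add_measure, lintegral_add_measure,
      lintegral_add_measure, hsymm]
    ring
  have h2 : 4 * posEnergy V σ ≤ 4 * posEnergy V ρ := by gcongr
  have h3 : 2 * (posEnergy V μ + posEnergy V σ) ≤ 4 * posEnergy V σ := by
    calc 2 * (posEnergy V μ + posEnergy V σ) ≤ 2 * (posEnergy V σ + posEnergy V σ) := by gcongr
      _ = _ := by ring
  have h5 := (h3.trans h2).trans_eq h4
  have hcancel : ∫⁻ p, posKernel p.1 p.2 ∂(μ.prod μ) + ∫⁻ p, posKernel p.1 p.2 ∂(σ.prod σ)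
      + 2 * (∫⁻ z, V z ∂μ + ∫⁻ z, V z ∂σ) ≠ ⊤ := by
    finiteness [hμ'.1, hμ'.2, hσ'.1, hσ'.2]
  refine (ENNReal.add_le_add_iff_right hcancel).1 ?_
  unfold posEnergy at h5
  calc _ = 2 * (∫⁻ p, posKernel p.1 p.2 ∂(μ.prod μ) + ∫⁻ z, V z ∂μ
        + (∫⁻ p, posKernel p.1 p.2 ∂(σ.prod σ) + ∫⁻ z, V z ∂σ)) := by ring
    _ ≤ _ := h5
    _ = _ := by ring

end Unique

/-! ### Compactness: configurations of almost minimal energy -/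

lemma iSup_min_natCast (x : ℝ≥0∞) : ⨆ N : ℕ, min x N = x := by
  have h := inf_iSup_eq x (fun N : ℕ => (N : ℝ≥0∞))
  rw [ENNReal.iSup_natCast, inf_top_eq] at h
  exact h.symm

lemma lintegral_eq_iSup_min {Ω : Type*} [MeasurableSpace Ω] (μ : Measure Ω) {f g : Ω → ℝ≥0∞}
    (hf : Measurable f) (hg : Measurable g) :
    ∫⁻ x, (f x + g x) ∂μ = ⨆ N : ℕ, ∫⁻ x, (min (f x) N + g x) ∂μ := by
  have hm : ∀ N : ℕ, Measurable fun x => min (f x) (N : ℝ≥0∞) + g x := fun N =>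
    (hf.min measurable_const).add hg
  rw [← lintegral_iSup hm]
  · refine lintegral_congr fun x => ?_
    rw [← ENNReal.iSup_add, iSup_min_natCast]
  · intro N N' h x
    dsimp only
    gcongr

/-- The integral of a nonnegative lower semicontinuous function is lower semicontinuous with
respect to weak convergence. -/
lemma lintegral_le_liminf_of_lowerSemicontinuous {Ω : Type*} [MeasurableSpace Ω]
    [TopologicalSpace Ω] [TopologicalSpace.PseudoMetrizableSpace Ω] [BorelSpace Ω]
    {μs : ℕ → ProbabilityMeasure Ω} {μ : ProbabilityMeasure Ω}
    (h : Tendsto μs atTop (𝓝 μ)) {f : Ω → ℝ≥0∞} (hf : LowerSemicontinuous f) :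
    ∫⁻ x, f x ∂(μ : Measure Ω) ≤ liminf (fun i => ∫⁻ x, f x ∂(μs i : Measure Ω)) atTop := by
  have hfm : Measurable f := hf.measurable
  have hsup := lintegral_eq_iSup_min (μ : Measure Ω) hfm measurable_zero
  simp only [Pi.zero_apply, add_zero] at hsup
  rw [hsup]
  refine iSup_le fun N => ?_
  have hne : ∀ x, min (f x) N ≠ ⊤ := fun x =>
    ne_top_of_le_ne_top (ENNReal.natCast_ne_top N) (min_le_right _ _)
  set F : Ω → ℝ := fun x => (min (f x) N).toReal
  have hFm : Measurable F := (hfm.min measurable_const).ennreal_toReal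
  have hF : ∀ x, ENNReal.ofReal (F x) = min (f x) N := fun x => ENNReal.ofReal_toReal (hne x)
  have hopen : ∀ t ∈ Set.Ioi (0 : ℝ), IsOpen {x | t < F x} := fun t ht => by
    have : {x | t < F x} = {x | ENNReal.ofReal t < f x} ∩ {_x | ENNReal.ofReal t < N} := by
      ext x
      change t < (min (f x) N).toReal ↔ ENNReal.ofReal t < f x ∧ ENNReal.ofReal t < N
      rw [← lt_min_iff, ← ENNReal.ofReal_lt_iff_lt_toReal (le_of_lt ht) (hne x)]
    rw [this]
    exact (hf.isOpen_preimage _).inter isOpen_const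
  calc ∫⁻ x, min (f x) N ∂(μ : Measure Ω) = ∫⁻ x, ENNReal.ofReal (F x) ∂(μ : Measure Ω) := by
        simp only [hF]
    _ = ∫⁻ t in Set.Ioi 0, (μ : Measure Ω) {x | t < F x} :=
        lintegral_eq_lintegral_meas_lt _ (ae_of_all _ fun _ => ENNReal.toReal_nonneg)
          hFm.aemeasurable
    _ ≤ ∫⁻ t in Set.Ioi (0 : ℝ), liminf (fun i => (μs i : Measure Ω) {x | t < F x}) atTop :=
        setLIntegral_mono' measurableSet_Ioi fun t ht =>
          ProbabilityMeasure.le_liminf_measure_open_of_tendsto h (hopen t ht)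
    _ ≤ liminf (fun i => ∫⁻ t in Set.Ioi (0 : ℝ), (μs i : Measure Ω) {x | t < F x}) atTop :=
        lintegral_liminf_le fun i => Antitone.measurable fun s t hst =>
          measure_mono fun x hx => lt_of_le_of_lt hst hx
    _ = liminf (fun i => ∫⁻ x, ENNReal.ofReal (F x) ∂(μs i : Measure Ω)) atTop := by
        congr 1
        ext i
        exact (lintegral_eq_lintegral_meas_lt _ (ae_of_all _ fun _ => ENNReal.toReal_nonneg)
          hFm.aemeasurable).symm
    _ ≤ _ := by
        refine liminf_le_liminf (Eventually.of_forall fun i => lintegral_mono fun x => ?_)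
        rw [hF]
        exact min_le_left _ _

/-- The empirical measure of a configuration. -/
noncomputable def empiricalMeasure (n : ℕ) (ζ : Fin n → ℂ) : Measure ℂ :=
  (n : ℝ≥0∞)⁻¹ • ∑ j, Measure.dirac (ζ j)

section Empirical

variable {n : ℕ} (ζ : Fin n → ℂ)

lemma isProbabilityMeasure_empiricalMeasure (hn : n ≠ 0) :
    IsProbabilityMeasure (empiricalMeasure n ζ) := ⟨by
  simp only [empiricalMeasure, Measure.smul_apply, Measure.coe_finsetSum, Finset.sum_apply,
    measure_univ, Finset.sum_const, Finset.card_univ, Fintype.card_fin, smul_eq_mul,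
    nsmul_eq_mul, mul_one]
  exact ENNReal.inv_mul_cancel (by exact_mod_cast hn) (ENNReal.natCast_ne_top n)⟩

lemma lintegral_empiricalMeasure (f : ℂ → ℝ≥0∞) :
    ∫⁻ z, f z ∂(empiricalMeasure n ζ) = (n : ℝ≥0∞)⁻¹ * ∑ j, f (ζ j) := by
  rw [empiricalMeasure, lintegral_smul_measure, lintegral_finsetSum_measure, smul_eq_mul]
  simp only [lintegral_dirac]

lemma integral_empiricalMeasure (f : BoundedContinuousFunction ℂ ℂ) :
    ∫ z, f z ∂(empiricalMeasure n ζ) = (1 / (n : ℂ)) * ∑ j, f (ζ j) := by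
  rw [empiricalMeasure, integral_smul_measure, integral_finsetSum_measure]
  · simp only [integral_dirac]
    rw [ENNReal.toReal_inv, ENNReal.toReal_natCast, Complex.real_smul]
    push_cast
    rw [one_div]
  · exact fun j _ => f.integrable _

/-- The discrete energy dominates the truncated energy of the empirical measure, up to the
diagonal terms, which the truncation makes small. -/
lemma lintegral_min_posKernel_empiricalMeasure_le {V : ℂ → ℝ≥0∞} (hV : Measurable V)
    (hn : n ≠ 0) (M : ℕ) :
    ∫⁻ p, (min (posKernel p.1 p.2) M + V p.1)
        ∂((empiricalMeasure n ζ).prod (empiricalMeasure n ζ))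
      ≤ ((n : ℝ≥0∞)⁻¹) ^ 2 * posHamiltonian V n ζ + (n : ℝ≥0∞)⁻¹ * M := by
  have hprob := isProbabilityMeasure_empiricalMeasure ζ hn
  have hn0 : (n : ℝ≥0∞) ≠ 0 := by exact_mod_cast hn
  have hinv : (n : ℝ≥0∞)⁻¹ * n = 1 := ENNReal.inv_mul_cancel hn0 (ENNReal.natCast_ne_top n)
  have hm : Measurable fun p : ℂ × ℂ => min (posKernel p.1 p.2) M + V p.1 :=
    (measurable_posKernel.min measurable_const).add (hV.comp measurable_fst)
  rw [lintegral_prod _ hm.aemeasurable]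
  simp only [lintegral_empiricalMeasure]
  have hsum : ∑ i, ∑ j, (min (posKernel (ζ i) (ζ j)) M + V (ζ i))
      ≤ posHamiltonian V n ζ + n * M := by
    have h1 : ∑ i, ∑ j, min (posKernel (ζ i) (ζ j)) (M : ℝ≥0∞)
        ≤ n * M + ∑ p ∈ (Finset.univ : Finset (Fin n)).offDiag, posKernel (ζ p.1) (ζ p.2) := by
      rw [← Finset.sum_product' (f := fun i j => min (posKernel (ζ i) (ζ j)) (M : ℝ≥0∞)),
        ← Finset.diag_union_offDiag, Finset.sum_union (Finset.disjoint_diag_offDiag _),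
        Finset.sum_diag]
      refine add_le_add ?_ (Finset.sum_le_sum fun p _ => min_le_left _ _)
      refine (Finset.sum_le_sum fun i _ => min_le_right _ _).trans_eq ?_
      simp
    simp only [Finset.sum_add_distrib, Finset.sum_const, Finset.card_univ, Fintype.card_fin,
      nsmul_eq_mul, ← Finset.mul_sum]
    unfold posHamiltonian
    calc _ ≤ n * M + ∑ p ∈ (Finset.univ : Finset (Fin n)).offDiag, posKernel (ζ p.1) (ζ p.2)
          + n * ∑ i, V (ζ i) := by gcongr
      _ = (∑ p ∈ (Finset.univ : Finset (Fin n)).offDiag, posKernel (ζ p.1) (ζ p.2)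
          + n * ∑ i, V (ζ i)) + n * M := by ring
      _ ≤ _ := add_le_add le_self_add le_rfl
  calc _ = ((n : ℝ≥0∞)⁻¹) ^ 2 * ∑ i, ∑ j, (min (posKernel (ζ i) (ζ j)) M + V (ζ i)) := by
        rw [← Finset.mul_sum, sq, mul_assoc]
    _ ≤ ((n : ℝ≥0∞)⁻¹) ^ 2 * (posHamiltonian V n ζ + n * M) := by gcongr
    _ = ((n : ℝ≥0∞)⁻¹) ^ 2 * posHamiltonian V n ζ
        + (n : ℝ≥0∞)⁻¹ * ((n : ℝ≥0∞)⁻¹ * n) * M := by ring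
    _ = _ := by rw [hinv, mul_one]

end Empirical

section Gap

variable {V : ℂ → ℝ≥0∞} {a : ℝ} {σ : Measure ℂ}

/-- Probability measures with bounded logarithmic moment form a tight family. -/
lemma exists_isCompact_of_logMoment_le {T : ℝ≥0∞} (hT : T ≠ ⊤) :
    ∃ S : Set (ProbabilityMeasure ℂ), IsCompact S ∧
      ∀ μ : ProbabilityMeasure ℂ, logMoment (μ : Measure ℂ) ≤ T → μ ∈ S := by
  set K : ℕ → Set ℂ := fun m => Metric.closedBall 0 (m + 1)
  set L : ℕ → ℝ := fun m => Real.log (1 + (m + 1))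
  set u : ℕ → NNReal := fun m => (T / ENNReal.ofReal (L m)).toNNReal
  have hL0 : ∀ m, 0 < L m := fun m => Real.log_pos (by
    have : (0 : ℝ) ≤ m := m.cast_nonneg
    linarith)
  have hL : Tendsto L atTop atTop := Real.tendsto_log_atTop.comp
    (tendsto_atTop_add_const_left _ _
      (tendsto_atTop_add_const_right _ _ tendsto_natCast_atTop_atTop))
  have hu : Tendsto u atTop (𝓝 0) := by
    have h1 : Tendsto (fun m => T / ENNReal.ofReal (L m)) atTop (𝓝 0) := by
      have := ENNReal.Tendsto.const_div (a := T) (ENNReal.tendsto_ofReal_nhds_top.2 hL)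
        (Or.inr hT)
      rwa [ENNReal.div_top] at this
    exact (ENNReal.tendsto_toNNReal ENNReal.zero_ne_top).comp h1
  refine ⟨_, isCompact_setOfPred_probabilityMeasure_mass_eq_compl_isCompact_le (K := K) hu
    (fun m => isCompact_closedBall _ _) (Or.inl inferInstance), fun μ hμ m => ?_⟩
  have hg := continuous_growthLog.measurable
  have hLne : ENNReal.ofReal (L m) ≠ 0 := (ENNReal.ofReal_pos.2 (hL0 m)).ne'
  have hmarkov : (μ : Measure ℂ) (K m)ᶜ ≤ T / ENNReal.ofReal (L m) := by
    have h1 := meas_ge_le_lintegral_div (μ := (μ : Measure ℂ)) (f := fun z =>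
      ENNReal.ofReal (growthLog z)) (by fun_prop) hLne ENNReal.ofReal_ne_top
    refine ((measure_mono fun z hz => ?_).trans h1).trans (ENNReal.div_le_div_right hμ _)
    have hz : ¬ ‖z‖ ≤ m + 1 := fun h => hz (mem_closedBall_zero_iff.2 h)
    have : (0 : ℝ) ≤ m := m.cast_nonneg
    exact ENNReal.ofReal_le_ofReal (Real.log_le_log (by positivity) (by linarith))
  rw [← ENNReal.coe_le_coe, ProbabilityMeasure.ennreal_coeFn_eq_coeFn_toMeasure,
    ENNReal.coe_toNNReal (ENNReal.div_ne_top hT hLne)]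
  exact hmarkov

/-- Configurations whose empirical measure is not close to the minimizer, as tested by one bounded
continuous function, have an energy that exceeds the minimum by a fixed amount. -/
lemma exists_energy_gap (hVl : LowerSemicontinuous V) (ha : 0 < a)
    (hV : ∀ z, ENNReal.ofReal (2 * a * growthLog z) ≤ V z) [IsProbabilityMeasure σ]
    (hσ : posEnergy V σ ≠ ⊤)
    (hmin : ∀ ν : Measure ℂ, IsProbabilityMeasure ν → posEnergy V σ ≤ posEnergy V ν)
    (f : BoundedContinuousFunction ℂ ℂ) {δ : ℝ} (hδ : 0 < δ) :
    ∃ c : ℝ, 0 < c ∧ ∃ N : ℕ, ∀ n ≥ N, ∀ ζ : Fin n → ℂ,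
      δ ≤ ‖(1 / (n : ℂ)) * ∑ j, f (ζ j) - ∫ z, f z ∂σ‖ →
      ENNReal.ofReal (n ^ 2 * ((posEnergy V σ).toReal + c)) ≤ posHamiltonian V n ζ := by
  by_contra! hcon
  have hVm : Measurable V := hVl.measurable
  set J : ℝ := (posEnergy V σ).toReal
  have hJ0 : 0 ≤ J := ENNReal.toReal_nonneg
  choose n hn ζ hζ hG using fun k : ℕ => hcon (1 / ((k : ℝ) + 1)) (by positivity) (k + 1)
  have hn0 : ∀ k, n k ≠ 0 := fun k => by have := hn k; omega
  have hnt : Tendsto n atTop atTop :=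
    tendsto_atTop_mono (fun k => (Nat.le_succ k).trans (hn k)) tendsto_id
  set μ : ℕ → ProbabilityMeasure ℂ := fun k =>
    ⟨empiricalMeasure (n k) (ζ k), isProbabilityMeasure_empiricalMeasure (ζ k) (hn0 k)⟩
  have hbound : ∀ M : ℕ, ∀ k, ∫⁻ p, (min (posKernel p.1 p.2) M + V p.1)
      ∂((μ k : Measure ℂ).prod (μ k : Measure ℂ))
      ≤ ENNReal.ofReal (J + 1 / ((k : ℝ) + 1)) + ((n k : ℕ) : ℝ≥0∞)⁻¹ * M := fun M k => by
    refine (lintegral_min_posKernel_empiricalMeasure_le (ζ k) hVm (hn0 k) M).trans ?_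
    gcongr
    have h1 : ((n k : ℕ) : ℝ≥0∞)⁻¹ ^ 2 * ((n k : ℕ) : ℝ≥0∞) ^ 2 = 1 := by
      rw [← mul_pow, ENNReal.inv_mul_cancel (by exact_mod_cast hn0 k) (ENNReal.natCast_ne_top _),
        one_pow]
    calc _ ≤ ((n k : ℕ) : ℝ≥0∞)⁻¹ ^ 2
          * ENNReal.ofReal ((n k) ^ 2 * (J + 1 / ((k : ℝ) + 1))) := by
          gcongr
          exact (hG k).le
      _ = _ := by
          rw [ENNReal.ofReal_mul (by positivity), ENNReal.ofReal_pow (by positivity),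
            ENNReal.ofReal_natCast, ← mul_assoc, h1, one_mul]
  -- tightness: the potential controls the logarithmic moment
  set T : ℝ≥0∞ := ENNReal.ofReal (J + 1) / ENNReal.ofReal (2 * a)
  have ha2 : ENNReal.ofReal (2 * a) ≠ 0 := (ENNReal.ofReal_pos.2 (by positivity)).ne'
  obtain ⟨S, hS, hmem⟩ := exists_isCompact_of_logMoment_le
    (T := T) (ENNReal.div_ne_top ENNReal.ofReal_ne_top ha2)
  have hmom : ∀ k, logMoment (μ k : Measure ℂ) ≤ T := fun k => by
    refine (ENNReal.le_div_iff_mul_le (Or.inl ha2) (Or.inl ENNReal.ofReal_ne_top)).2 ?_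
    rw [mul_comm]
    refine (logMoment_le ha hV _).trans ?_
    have h1 := hbound 0 k
    rw [Nat.cast_zero, mul_zero, add_zero] at h1
    simp only [min_zero, zero_add] at h1
    rw [← (measurePreserving_fst (μ := (μ k : Measure ℂ)) (ν := (μ k : Measure ℂ))).lintegral_comp
      hVm]
    refine h1.trans (ENNReal.ofReal_le_ofReal ?_)
    have : 1 / ((k : ℝ) + 1) ≤ 1 := by
      rw [div_le_one (by positivity)]
      linarith [(k.cast_nonneg : (0 : ℝ) ≤ k)]
    linarith
  obtain ⟨μ', -, φ, hφ, hlim⟩ := hS.tendsto_subseq fun k => hmem (μ k) (hmom k)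
  -- the limit has at most the minimal energy
  have hle : posEnergy V (μ' : Measure ℂ) ≤ posEnergy V σ := by
    have hsplit : posEnergy V (μ' : Measure ℂ)
        = ∫⁻ p, (posKernel p.1 p.2 + V p.1) ∂((μ' : Measure ℂ).prod (μ' : Measure ℂ)) := by
      rw [lintegral_add_left measurable_posKernel, posEnergy,
        (measurePreserving_fst (μ := (μ' : Measure ℂ)) (ν := (μ' : Measure ℂ))).lintegral_comp hVm]
    rw [hsplit, lintegral_eq_iSup_min _ (f := fun p : ℂ × ℂ => posKernel p.1 p.2)
      (g := fun p : ℂ × ℂ => V p.1) measurable_posKernel (hVm.comp measurable_fst)]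
    refine iSup_le fun M => ?_
    have hlsc : LowerSemicontinuous fun p : ℂ × ℂ => min (posKernel p.1 p.2) (M : ℝ≥0∞) + V p.1 :=
      (continuous_posKernel.min continuous_const).lowerSemicontinuous.add
        (hVl.comp continuous_fst)
    have hprod : Tendsto (fun k => (μ (φ k)).prod (μ (φ k))) atTop (𝓝 (μ'.prod μ')) :=
      (ProbabilityMeasure.continuous_prod.tendsto (μ', μ')).comp (hlim.prodMk_nhds hlim)
    have h1 := lintegral_le_liminf_of_lowerSemicontinuous hprod hlsc
    refine h1.trans ?_
    have hup : Tendsto (fun k => ENNReal.ofReal (J + 1 / ((φ k : ℝ) + 1))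
        + ((n (φ k) : ℕ) : ℝ≥0∞)⁻¹ * M) atTop (𝓝 (ENNReal.ofReal (J + 0) + 0 * M)) := by
      refine Tendsto.add (ENNReal.tendsto_ofReal (tendsto_const_nhds.add ?_))
        (ENNReal.Tendsto.mul_const ?_ (Or.inr (ENNReal.natCast_ne_top M)))
      · exact tendsto_one_div_add_atTop_nhds_zero_nat.comp hφ.tendsto_atTop
      · exact ENNReal.tendsto_inv_nat_nhds_zero.comp (hnt.comp hφ.tendsto_atTop)
    rw [add_zero, zero_mul, add_zero, ENNReal.ofReal_toReal hσ] at hup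
    rw [← hup.liminf_eq]
    exact liminf_le_liminf (Eventually.of_forall fun k => hbound M (φ k))
  have heq : (μ' : Measure ℂ) = σ := eq_of_posEnergy_le ha hV hσ hmin hle
  have hint := (ProbabilityMeasure.tendsto_iff_forall_integral_rclike_tendsto ℂ).1 hlim f
  rw [heq] at hint
  have hdist := (hint.sub_const (∫ z, f z ∂σ)).norm
  rw [sub_self, norm_zero] at hdist
  refine absurd (ge_of_tendsto hdist (Eventually.of_forall fun k => ?_)) (not_le.2 hδ)
  have h1 := hζ (φ k)
  rwa [← integral_empiricalMeasure] at h1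

end Gap

/-! ### Concentration of the Gibbs measure -/

instance : Measure.IsAddHaarMeasure areaMeasure := by
  unfold areaMeasure
  exact Measure.IsAddHaarMeasure.smul _ (ENNReal.inv_ne_zero.2 ENNReal.ofReal_ne_top)
    (ENNReal.inv_ne_top.2 (ENNReal.ofReal_pos.2 Real.pi_pos).ne')

lemma lintegral_pi_prod_eq_pow {E : Type*} [MeasurableSpace E] (μ : Measure E) [SigmaFinite μ]
    {f : E → ℝ} (hf : Integrable f μ) (hf0 : ∀ z, 0 ≤ f z) (n : ℕ) :
    ∫⁻ ζ, ENNReal.ofReal (∏ j, f (ζ j)) ∂(Measure.pi fun _ : Fin n => μ)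
      = ENNReal.ofReal (∫ z, f z ∂μ) ^ n := by
  rw [← ofReal_integral_eq_lintegral_ofReal (Integrable.fintype_prod fun _ => hf)
    (ae_of_all _ fun ζ => Finset.prod_nonneg fun j _ => hf0 _),
    integral_fintype_prod_eq_prod (𝕜 := ℝ) (fun _ : Fin n => f), Finset.prod_const,
    Finset.card_univ, Fintype.card_fin, ENNReal.ofReal_pow (integral_nonneg hf0)]

lemma expWeight_ofReal (β : ℝ) {g : ℝ} (hg : 0 ≤ g) :
    expWeight β (ENNReal.ofReal g) = ENNReal.ofReal (Real.exp (-(β * g))) := by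
  rw [ENNReal.ofReal, expWeight_coe, Real.coe_toNNReal _ hg]

lemma expWeight_add_left {β γ : ℝ} (hβ : 0 < β) (hγ : 0 < γ) (x : ℝ≥0∞) :
    expWeight (β + γ) x = expWeight β x * expWeight γ x := by
  induction x using ENNReal.recTopCoe with
  | top => rw [expWeight_top hβ, expWeight_top (add_pos hβ hγ), zero_mul]
  | coe g =>
    rw [expWeight_coe, expWeight_coe, expWeight_coe, ← ENNReal.ofReal_mul (Real.exp_pos _).le,
      ← Real.exp_add]
    congr 2
    ring

section Upper

variable {V : ℂ → ℝ≥0∞} {a : ℝ}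

lemma measurable_expWeight_posHamiltonian (hV : Measurable V) (n : ℕ) {β : ℝ} (hβ : 0 ≤ β) :
    Measurable fun ζ : Fin n → ℂ => expWeight β (posHamiltonian V n ζ) :=
  (measurable_expWeight hβ).comp (measurable_posHamiltonian hV n)

/-- At an inverse temperature of order `1 / n`, the partition function grows at most
exponentially in `n`. -/
lemma lintegral_expWeight_posHamiltonian_le
    (hV : ∀ z, ENNReal.ofReal (2 * a * growthLog z) ≤ V z) (ha : 0 < a) {n : ℕ} {β : ℝ}
    (hβ : 0 ≤ β) (h : 3 ≤ 2 * a * (n * β)) :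
    ∫⁻ ζ, expWeight β (posHamiltonian V n ζ) ∂(Measure.pi fun _ : Fin n => areaMeasure)
      ≤ ENNReal.ofReal (∫ z : ℂ, (1 + ‖z‖) ^ (-3 : ℝ) ∂areaMeasure) ^ n := by
  have hint : Integrable (fun z : ℂ => (1 + ‖z‖) ^ (-3 : ℝ)) areaMeasure :=
    integrable_one_add_norm (by rw [Complex.finrank_real_complex]; norm_num)
  rw [← lintegral_pi_prod_eq_pow areaMeasure hint (fun z => by positivity)]
  refine lintegral_mono fun ζ => ?_
  have h1 : ENNReal.ofReal (n * ∑ j, 2 * a * growthLog (ζ j)) ≤ posHamiltonian V n ζ := by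
    rw [ENNReal.ofReal_mul n.cast_nonneg, ENNReal.ofReal_natCast, ENNReal.ofReal_sum_of_nonneg
      fun j _ => mul_nonneg (by positivity) (growthLog_nonneg _)]
    unfold posHamiltonian
    calc (n : ℝ≥0∞) * ∑ j, ENNReal.ofReal (2 * a * growthLog (ζ j))
        ≤ n * ∑ j, V (ζ j) := by gcongr with j; exact hV _
      _ ≤ _ := le_add_self.trans le_self_add
  have h2 : 0 ≤ ∑ j, growthLog (ζ j) := Finset.sum_nonneg fun j _ => growthLog_nonneg _
  refine (expWeight_anti hβ h1).trans ?_
  rw [← Finset.mul_sum, expWeight_ofReal _ (by positivity)]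
  refine ENNReal.ofReal_le_ofReal ?_
  have h3 : ∏ j, (1 + ‖ζ j‖) ^ (-3 : ℝ) = Real.exp (-(3 * ∑ j, growthLog (ζ j))) := by
    rw [Finset.mul_sum, ← Finset.sum_neg_distrib, Real.exp_sum]
    refine Finset.prod_congr rfl fun j _ => ?_
    rw [Real.rpow_def_of_pos (by positivity), growthLog]
    congr 1
    ring
  rw [h3]
  refine Real.exp_le_exp.2 (neg_le_neg ?_)
  nlinarith

/-- If the Hamiltonian is at least `g` on `A`, then the part `t` of the inverse temperature
`t + s` produces the factor `exp (-t g)`, and the part `s` makes the integral converge. -/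
lemma setLIntegral_expWeight_le (hVm : Measurable V) {n : ℕ} {A : Set (Fin n → ℂ)} {g t s : ℝ}
    (hg : 0 ≤ g) (hA : ∀ ζ ∈ A, ENNReal.ofReal g ≤ posHamiltonian V n ζ) (ht : 0 < t)
    (hs : 0 < s) (hAm : MeasurableSet A) :
    ∫⁻ ζ in A, expWeight (t + s) (posHamiltonian V n ζ)
        ∂(Measure.pi fun _ : Fin n => areaMeasure)
      ≤ ENNReal.ofReal (Real.exp (-(t * g))) * ∫⁻ ζ, expWeight s (posHamiltonian V n ζ)
        ∂(Measure.pi fun _ : Fin n => areaMeasure) := by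
  rw [← lintegral_const_mul _
    (measurable_expWeight_posHamiltonian hVm n hs.le)]
  refine le_trans (setLIntegral_mono' hAm fun ζ hζ => ?_) (setLIntegral_le_lintegral A _)
  rw [expWeight_add_left ht hs]
  gcongr
  rw [← expWeight_ofReal t hg]
  exact expWeight_anti ht.le (hA ζ hζ)

end Upper

section Gibbs

variable {Q : ℂ → EReal} {a C : ℝ} {σ : Measure ℂ} {β : ℕ → ℝ}

lemma partitionFunction_eq (hQ : LowerSemicontinuous Q) (ha : 0 < a)
    (hC : ∀ z, (((2 + 2 * a) * growthLog z - C : ℝ) : EReal) ≤ Q z) (n : ℕ) {β : ℝ}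
    (hβ : 0 ≤ β) :
    partitionFunction Q n β = ENNReal.ofReal (Real.exp (β * (C * n ^ 2)))
      * ∫⁻ ζ, expWeight β (posHamiltonian (posPotential Q C) n ζ)
          ∂(Measure.pi fun _ : Fin n => areaMeasure) := by
  have hVm := (lowerSemicontinuous_posPotential hQ C).measurable
  unfold partitionFunction
  simp only [boltzmannFactor_eq ha hC n hβ]
  exact lintegral_const_mul _ (measurable_expWeight_posHamiltonian hVm n hβ)

lemma gibbsMeasure_eq (hQ : LowerSemicontinuous Q) (ha : 0 < a)
    (hC : ∀ z, (((2 + 2 * a) * growthLog z - C : ℝ) : EReal) ≤ Q z) (n : ℕ) {β : ℝ}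
    (hβ : 0 ≤ β) :
    gibbsMeasure Q n β = (∫⁻ ζ, expWeight β (posHamiltonian (posPotential Q C) n ζ)
          ∂(Measure.pi fun _ : Fin n => areaMeasure))⁻¹ •
      (Measure.pi fun _ : Fin n => areaMeasure).withDensity
        fun ζ => expWeight β (posHamiltonian (posPotential Q C) n ζ) := by
  have hVm := (lowerSemicontinuous_posPotential hQ C).measurable
  set e := ENNReal.ofReal (Real.exp (β * (C * n ^ 2)))
  have he : e ≠ 0 := (ENNReal.ofReal_pos.2 (Real.exp_pos _)).ne'
  have he' : e ≠ ⊤ := ENNReal.ofReal_ne_top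
  have hb : boltzmannFactor Q n β
      = e • fun ζ => expWeight β (posHamiltonian (posPotential Q C) n ζ) :=
    funext fun ζ => boltzmannFactor_eq ha hC n hβ ζ
  rw [gibbsMeasure, partitionFunction_eq hQ ha hC n hβ, hb, withDensity_smul _
    (measurable_expWeight_posHamiltonian hVm n hβ), smul_smul,
    ENNReal.mul_inv (Or.inl he) (Or.inl he'), mul_right_comm, ENNReal.inv_mul_cancel he he',
    one_mul]

lemma partitionFunction_ne_zero_and_ne_top (hQ : IsExternalPotential Q) (ha : 0 < a)
    (hC : ∀ z, (((2 + 2 * a) * growthLog z - C : ℝ) : EReal) ≤ Q z) [IsProbabilityMeasure σ]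
    (hσ : IsCompact σ.support) (hS : σ.support ⊆ interior (finiteSet Q))
    (hfin : posEnergy (posPotential Q C) σ < ⊤)
    (hβ : Tendsto (fun n : ℕ => (n : ℝ) * β n) atTop atTop) :
    ∀ᶠ n in atTop, partitionFunction Q n (β n) ≠ 0 ∧ partitionFunction Q n (β n) ≠ ⊤ := by
  filter_upwards [eventually_le_lintegral_expWeight hQ hσ hS hfin hβ one_pos,
    (hβ.const_mul_atTop (by positivity : 0 < 2 * a)).eventually_ge_atTop 3,
    hβ.eventually_gt_atTop 0] with n h1 h2 h3
  have hβn : 0 ≤ β n := (pos_of_mul_pos_right h3 n.cast_nonneg).le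
  rw [partitionFunction_eq hQ.lowerSemicontinuous ha hC n hβn]
  refine ⟨mul_ne_zero (ENNReal.ofReal_pos.2 (Real.exp_pos _)).ne' ?_,
    ENNReal.mul_ne_top ENNReal.ofReal_ne_top ?_⟩
  · exact ((ENNReal.ofReal_pos.2 (Real.exp_pos _)).trans_le h1).ne'
  · exact ((lintegral_expWeight_posHamiltonian_le (growthLog_le_posPotential hC) ha hβn
      h2).trans_lt (ENNReal.pow_lt_top ENNReal.ofReal_lt_top)).ne

lemma isProbabilityMeasure_gibbsMeasure {n : ℕ} {β : ℝ} (h0 : partitionFunction Q n β ≠ 0)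
    (h1 : partitionFunction Q n β ≠ ⊤) : IsProbabilityMeasure (gibbsMeasure Q n β) := ⟨by
  rw [gibbsMeasure, Measure.smul_apply, withDensity_apply _ MeasurableSet.univ,
    setLIntegral_univ, smul_eq_mul]
  exact ENNReal.inv_mul_cancel h0 h1⟩

/-- Under the Gibbs measure, a linear statistic deviates from its equilibrium value with
probability at most `exp (-n)`: the energy gap, multiplied by `β_n n²`, beats the factor
exponential in `n` that is lost in the bounds for the partition function. -/
lemma eventually_gibbsMeasure_le (hQ : IsExternalPotential Q) (ha : 0 < a)
    (hC : ∀ z, (((2 + 2 * a) * growthLog z - C : ℝ) : EReal) ≤ Q z)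
    (hσ : IsEquilibriumMeasure Q σ) (hS : σ.support ⊆ interior (finiteSet Q))
    (hβ : Tendsto (fun n : ℕ => (n : ℝ) * β n) atTop atTop)
    (f : BoundedContinuousFunction ℂ ℂ) {δ : ℝ} (hδ : 0 < δ) :
    ∀ᶠ n : ℕ in atTop, gibbsMeasure Q n (β n)
      {ζ | δ ≤ ‖(1 / (n : ℂ)) * ∑ j, f (ζ j) - ∫ z, f z ∂σ‖} ≤ ENNReal.ofReal (Real.exp (-n)) := by
  have := hσ.isProbabilityMeasure
  have hfin := posEnergy_lt_top hQ ha hC hσ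
  have hVl := lowerSemicontinuous_posPotential hQ.lowerSemicontinuous C
  have hV := growthLog_le_posPotential hC
  obtain ⟨c, hc, N, hgap⟩ := exists_energy_gap hVl ha hV hfin.ne
    (fun ν hν => posEnergy_le hQ.lowerSemicontinuous ha hC hσ ν) f hδ
  set V := posPotential Q C
  set J : ℝ := (posEnergy V σ).toReal
  have hJ : 0 ≤ J := ENNReal.toReal_nonneg
  set D : ℝ := ∫ z : ℂ, (1 + ‖z‖) ^ (-3 : ℝ) ∂areaMeasure
  -- the share of the inverse temperature spent on integrability costs `c / 2` of the energy gap
  set s : ℝ := c / (2 * (J + c))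
  have hs0 : 0 < s := by positivity
  have hs : s * (J + c) = c / 2 := by simp only [s]; field_simp
  have hs1 : s < 1 := by
    simp only [s]
    rw [div_lt_one (by positivity)]
    linarith
  filter_upwards [eventually_ge_atTop N, hβ.eventually_gt_atTop 0,
    eventually_le_lintegral_expWeight hQ hσ.isCompact_support hS hfin hβ
      (η := c / 4) (by positivity),
    (hβ.const_mul_atTop (by positivity : 0 < 2 * a * s)).eventually_ge_atTop 3,
    (hβ.const_mul_atTop (by positivity : 0 < c / 4)).eventually_ge_atTop (D + 1)]
    with n hn h0 hZ h3 h4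
  have hβn : 0 < β n := pos_of_mul_pos_right h0 n.cast_nonneg
  set A := {ζ : Fin n → ℂ | δ ≤ ‖(1 / (n : ℂ)) * ∑ j, f (ζ j) - ∫ z, f z ∂σ‖}
  have hAm : MeasurableSet A := by
    refine (isClosed_le continuous_const ?_).measurableSet
    have := f.continuous
    fun_prop
  set Z := ∫⁻ ζ, expWeight (β n) (posHamiltonian V n ζ)
    ∂(Measure.pi fun _ : Fin n => areaMeasure)
  have hA := setLIntegral_expWeight_le hVl.measurable (t := (1 - s) * β n) (s := s * β n)
    (by positivity) (hgap n hn) (mul_pos (by linarith) hβn) (mul_pos hs0 hβn) hAm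
  rw [← add_mul, sub_add_cancel, one_mul] at hA
  have hD : ENNReal.ofReal D ^ n ≤ ENNReal.ofReal (Real.exp (n * D)) := by
    rw [← ENNReal.ofReal_pow (integral_nonneg fun z => by positivity), Real.exp_nat_mul]
    refine ENNReal.ofReal_le_ofReal (pow_le_pow_left₀ (integral_nonneg fun z => by positivity) ?_ n)
    linarith [Real.add_one_le_exp D]
  have hfree := (lintegral_expWeight_posHamiltonian_le hV ha (β := s * β n) (by positivity)
    (n := n) (by linarith)).trans hD
  rw [gibbsMeasure_eq hQ.lowerSemicontinuous ha hC n hβn.le, Measure.smul_apply,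
    withDensity_apply _ hAm, smul_eq_mul]
  calc Z⁻¹ * ∫⁻ ζ in A, expWeight (β n) (posHamiltonian V n ζ)
        ∂(Measure.pi fun _ : Fin n => areaMeasure)
      ≤ (ENNReal.ofReal (Real.exp (-(β n * n ^ 2 * (J + c / 4)))))⁻¹
        * (ENNReal.ofReal (Real.exp (-((1 - s) * β n * (n ^ 2 * (J + c)))))
          * ENNReal.ofReal (Real.exp (n * D))) := by
        gcongr
        exact hA.trans (by gcongr)
    _ = ENNReal.ofReal (Real.exp (β n * n ^ 2 * (J + c / 4)
          + (-((1 - s) * β n * (n ^ 2 * (J + c))) + n * D))) := by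
        rw [← ENNReal.ofReal_inv_of_pos (Real.exp_pos _), ← Real.exp_neg, neg_neg,
          ← ENNReal.ofReal_mul (Real.exp_pos _).le, ← ENNReal.ofReal_mul (Real.exp_pos _).le,
          ← Real.exp_add, ← Real.exp_add]
    _ ≤ _ := by
        refine ENNReal.ofReal_le_ofReal (Real.exp_le_exp.2 ?_)
        have e1 : (1 - s) * β n * (n ^ 2 * (J + c)) = β n * n ^ 2 * (J + c / 2) := by
          linear_combination (-(β n * n ^ 2)) * hs
        have e2 := mul_le_mul_of_nonneg_left h4 (n.cast_nonneg : (0 : ℝ) ≤ n)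
        rw [e1]
        nlinarith

/-- Concentration and boundedness give convergence of the means of linear statistics. -/
lemma tendsto_integral_gibbsMeasure (hQ : IsExternalPotential Q) (ha : 0 < a)
    (hC : ∀ z, (((2 + 2 * a) * growthLog z - C : ℝ) : EReal) ≤ Q z)
    (hσ : IsEquilibriumMeasure Q σ) (hS : σ.support ⊆ interior (finiteSet Q))
    (hβ : Tendsto (fun n : ℕ => (n : ℝ) * β n) atTop atTop)
    (f : BoundedContinuousFunction ℂ ℂ) :
    Tendsto (fun n : ℕ => ∫ ζ, (1 / (n : ℂ)) * ∑ j, f (ζ j) ∂(gibbsMeasure Q n (β n))) atTop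
      (𝓝 (∫ z, f z ∂σ)) := by
  have := hσ.isProbabilityMeasure
  have hfin := posEnergy_lt_top hQ ha hC hσ
  set m := ∫ z, f z ∂σ
  have hm : ‖m‖ ≤ ‖f‖ := by
    refine (norm_integral_le_of_norm_le_const (ae_of_all _ f.norm_coe_le_norm)).trans_eq ?_
    rw [probReal_univ, mul_one]
  refine Metric.tendsto_nhds.2 fun ε hε => ?_
  have hsmall : Tendsto (fun n : ℕ => ε / 2 + 2 * ‖f‖ * Real.exp (-n)) atTop
      (𝓝 (ε / 2 + 2 * ‖f‖ * 0)) :=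
    ((Real.tendsto_exp_neg_atTop_nhds_zero.comp tendsto_natCast_atTop_atTop).const_mul _).const_add
      _
  filter_upwards [eventually_gibbsMeasure_le hQ ha hC hσ hS hβ f (half_pos hε),
    partitionFunction_ne_zero_and_ne_top hQ ha hC hσ.isCompact_support hS hfin hβ,
    hsmall.eventually_lt_const (show ε / 2 + 2 * ‖f‖ * 0 < ε by linarith),
    eventually_gt_atTop 0] with n hA hZ hlt hn
  have hP := isProbabilityMeasure_gibbsMeasure hZ.1 hZ.2
  set P := gibbsMeasure Q n (β n)
  set F : (Fin n → ℂ) → ℂ := fun ζ => (1 / (n : ℂ)) * ∑ j, f (ζ j)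
  have hFc : Continuous F := by
    have := f.continuous
    fun_prop
  have hn' : (0 : ℝ) < n := by exact_mod_cast hn
  have hFb : ∀ ζ, ‖F ζ‖ ≤ ‖f‖ := fun ζ => by
    have h1 : ‖∑ j, f (ζ j)‖ ≤ n * ‖f‖ := by
      refine (norm_sum_le_of_le _ fun j _ => f.norm_coe_le_norm _).trans_eq ?_
      simp
    simp only [F]
    rw [norm_mul, norm_div, norm_one, Complex.norm_natCast, one_div, inv_mul_le_iff₀ hn']
    exact h1
  have hFi : Integrable F P :=
    Integrable.of_bound hFc.aestronglyMeasurable ‖f‖ (ae_of_all _ hFb)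
  set A := {ζ : Fin n → ℂ | ε / 2 ≤ ‖F ζ - m‖}
  have hAm : MeasurableSet A := (isClosed_le continuous_const (by fun_prop)).measurableSet
  have hPA : P.real A ≤ Real.exp (-n) := ENNReal.toReal_le_of_le_ofReal (Real.exp_pos _).le hA
  have hpt : ∀ ζ, ‖F ζ - m‖ ≤ ε / 2 + A.indicator (fun _ => 2 * ‖f‖) ζ := fun ζ => by
    by_cases hζ : ζ ∈ A
    · rw [Set.indicator_of_mem hζ]
      linarith [norm_sub_le (F ζ) m, hFb ζ]
    · rw [Set.indicator_of_notMem hζ, add_zero]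
      exact (not_le.1 hζ).le
  have hind : Integrable (A.indicator fun _ => 2 * ‖f‖) P :=
    (integrable_const _).indicator hAm
  refine lt_of_le_of_lt ?_ hlt
  calc dist (∫ ζ, F ζ ∂P) m = ‖∫ ζ, (F ζ - m) ∂P‖ := by
        rw [dist_eq_norm, integral_sub hFi (integrable_const m), integral_const, probReal_univ,
          one_smul]
    _ ≤ ∫ ζ, (ε / 2 + A.indicator (fun _ => 2 * ‖f‖) ζ) ∂P :=
        norm_integral_le_of_norm_le ((integrable_const _).add hind) (ae_of_all _ hpt)
    _ = ε / 2 + P.real A * (2 * ‖f‖) := by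
        rw [integral_add (integrable_const _) hind, integral_const, probReal_univ, one_smul,
          integral_indicator_const _ hAm, smul_eq_mul]
    _ ≤ _ := by
        have := mul_le_mul_of_nonneg_right hPA (show 0 ≤ 2 * ‖f‖ by positivity)
        linarith

end Gibbs

/-! ### The one-point function -/

section OnePoint

variable (Q : ℂ → EReal) (n : ℕ) (β : ℝ)

/-- The intensity measure of the Gibbs measure: the measure of a set is the expected number of
points in it. -/
noncomputable def intensityMeasure : Measure ℂ :=
  ∑ j, (gibbsMeasure Q n β).map fun ζ : Fin n → ℂ => ζ j

instance [IsFiniteMeasure (gibbsMeasure Q n β)] : IsFiniteMeasure (intensityMeasure Q n β) := by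
  unfold intensityMeasure
  infer_instance

lemma intensityMeasure_absolutelyContinuous : intensityMeasure Q n β ≪ areaMeasure := by
  have h1 : gibbsMeasure Q n β ≪ Measure.pi fun _ : Fin n => areaMeasure :=
    Measure.smul_absolutelyContinuous.trans (withDensity_absolutelyContinuous _ _)
  refine Measure.AbsolutelyContinuous.mk fun s hs h0 => ?_
  simp only [intensityMeasure, Measure.coe_finsetSum, Finset.sum_apply]
  refine Finset.sum_eq_zero fun j _ => ?_
  rw [Measure.map_apply (measurable_pi_apply j) hs]
  exact h1 ((Measure.quasiMeasurePreserving_eval _ j).preimage_null h0)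

variable [IsFiniteMeasure (gibbsMeasure Q n β)]

lemma expectedCount_eq {W : Set ℂ} (hW : MeasurableSet W) :
    expectedCount Q n β W = (intensityMeasure Q n β).real W := by
  classical
  have hcount : ∀ ζ : Fin n → ℂ, (({j | ζ j ∈ W} : Set (Fin n)).ncard : ℝ)
      = ∑ j, ((fun ζ : Fin n → ℂ => ζ j) ⁻¹' W).indicator (fun _ => (1 : ℝ)) ζ := fun ζ => by
    rw [Set.ncard_eq_toFinset_card']
    simp [Set.indicator_apply, Finset.sum_boole]
  have hm : ∀ j, MeasurableSet ((fun ζ : Fin n → ℂ => ζ j) ⁻¹' W) := fun j =>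
    measurable_pi_apply j hW
  simp only [expectedCount, hcount]
  rw [integral_finsetSum _ fun j _ => (integrable_const _).indicator (hm j)]
  simp only [measureReal_def, intensityMeasure, Measure.coe_finsetSum, Finset.sum_apply]
  rw [ENNReal.toReal_sum fun j _ => measure_ne_top _ _]
  refine Finset.sum_congr rfl fun j _ => ?_
  rw [integral_indicator_const _ (hm j), Measure.map_apply (measurable_pi_apply j) hW, smul_eq_mul,
    mul_one, measureReal_def]

lemma areaMeasure_closedBall (z : ℂ) {ε : ℝ} (hε : 0 ≤ ε) :
    areaMeasure (Metric.closedBall z ε) = ENNReal.ofReal (ε ^ 2) := by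
  have hπ : ENNReal.ofReal Real.pi = (NNReal.pi : ℝ≥0∞) := by
    rw [← NNReal.coe_real_pi, ENNReal.ofReal_coe_nnreal]
  rw [areaMeasure, Measure.smul_apply, Complex.volume_closedBall, smul_eq_mul, hπ, mul_left_comm,
    ENNReal.inv_mul_cancel (by simpa using NNReal.pi_ne_zero) ENNReal.coe_ne_top, mul_one,
    ENNReal.ofReal_pow hε]

/-- By differentiation of measures, the limit in the definition of the one-point function exists
almost everywhere, and it is the density of the intensity measure. -/
lemma ae_tendsto_expectedCount :
    ∀ᵐ z ∂areaMeasure, Tendsto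
      (fun ε : ℝ => expectedCount Q n β (Metric.ball z ε) / ε ^ 2) (𝓝[>] 0)
      (𝓝 ((intensityMeasure Q n β).rnDeriv areaMeasure z).toReal) := by
  filter_upwards [Besicovitch.ae_tendsto_rnDeriv (intensityMeasure Q n β) areaMeasure,
    Measure.rnDeriv_lt_top (intensityMeasure Q n β) areaMeasure] with z hz hlt
  refine ((ENNReal.tendsto_toReal hlt.ne).comp hz).congr' ?_
  filter_upwards [self_mem_nhdsWithin] with ε hε
  have hε : 0 < ε := hε
  have hball : intensityMeasure Q n β (Metric.closedBall z ε)
      = intensityMeasure Q n β (Metric.ball z ε) := by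
    rw [← Metric.ball_union_sphere,
      measure_union Metric.sphere_disjoint_ball.symm Metric.isClosed_sphere.measurableSet,
      intensityMeasure_absolutelyContinuous Q n β (Measure.addHaar_sphere _ _ _), add_zero]
  rw [Function.comp_apply, expectedCount_eq Q n β measurableSet_ball, ENNReal.toReal_div, hball,
    areaMeasure_closedBall z hε.le, ENNReal.toReal_ofReal (by positivity), measureReal_def]

lemma onePointFunction_ae_eq : onePointFunction Q n β =ᵐ[areaMeasure]
    fun z => ((intensityMeasure Q n β).rnDeriv areaMeasure z).toReal := by
  filter_upwards [ae_tendsto_expectedCount Q n β] with z hz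
  exact hz.limUnder_eq

lemma integrable_onePointFunction : Integrable (onePointFunction Q n β) areaMeasure :=
  Measure.integrable_toReal_rnDeriv.congr (onePointFunction_ae_eq Q n β).symm

lemma integral_mul_onePointFunction (f : BoundedContinuousFunction ℂ ℂ) :
    ∫ z, f z * (onePointFunction Q n β z : ℂ) ∂areaMeasure
      = ∫ ζ, ∑ j, f (ζ j) ∂(gibbsMeasure Q n β) := by
  calc ∫ z, f z * (onePointFunction Q n β z : ℂ) ∂areaMeasure
      = ∫ z, ((intensityMeasure Q n β).rnDeriv areaMeasure z).toReal • f z ∂areaMeasure := by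
        refine integral_congr_ae ?_
        filter_upwards [onePointFunction_ae_eq Q n β] with z hz
        rw [hz, Complex.real_smul, mul_comm]
    _ = ∫ z, f z ∂(intensityMeasure Q n β) :=
        integral_rnDeriv_smul (intensityMeasure_absolutelyContinuous Q n β)
    _ = _ := by
        rw [intensityMeasure, integral_finsetSum_measure fun j _ => f.integrable _,
          integral_finsetSum _ fun j _ => ?_]
        · refine Finset.sum_congr rfl fun j _ => ?_
          exact integral_map (measurable_pi_apply j).aemeasurable
            f.continuous.aestronglyMeasurable
        · exact Integrable.of_bound
            (f.continuous.comp (continuous_apply j)).aestronglyMeasurable ‖f‖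
            (ae_of_all _ fun ζ => f.norm_coe_le_norm _)

end OnePoint

end CoulombGas

theorem mainTheorem5
    (Q : ℂ → EReal) (hQ : IsExternalPotential Q)
    (σ : Measure ℂ) (hσ : IsEquilibriumMeasure Q σ)
    (hS : σ.support ⊆ interior (finiteSet Q))
    (β : ℕ → ℝ) (hβ : Tendsto (fun n : ℕ => (n : ℝ) * β n) atTop atTop) :
    (∀ᶠ n in atTop,
      (0 < partitionFunction Q n (β n) ∧ partitionFunction Q n (β n) < ⊤) ∧
      (∀ᵐ z ∂areaMeasure, Tendsto
        (fun ε : ℝ => expectedCount Q n (β n) (Metric.ball z ε) / ε ^ 2)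
        (𝓝[>] 0) (𝓝 (onePointFunction Q n (β n) z))) ∧
      Integrable (onePointFunction Q n (β n)) areaMeasure) ∧
    ∀ f : BoundedContinuousFunction ℂ ℂ,
      Tendsto
        (fun n : ℕ => (1 / (n : ℂ)) *
          ∫ z, f z * (onePointFunction Q n (β n) z : ℂ) ∂areaMeasure)
        atTop (𝓝 (∫ z, f z ∂σ)) := by
  have := hσ.isProbabilityMeasure
  obtain ⟨a, ha, C, hC⟩ := exists_growthLog_bound hQ
  have hZ := partitionFunction_ne_zero_and_ne_top hQ ha hC hσ.isCompact_support hS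
    (posEnergy_lt_top hQ ha hC hσ) hβ
  refine ⟨?_, fun f => ?_⟩
  · filter_upwards [hZ] with n hn
    have := isProbabilityMeasure_gibbsMeasure hn.1 hn.2
    refine ⟨⟨pos_iff_ne_zero.2 hn.1, lt_top_iff_ne_top.2 hn.2⟩, ?_,
      integrable_onePointFunction Q n (β n)⟩
    filter_upwards [ae_tendsto_expectedCount Q n (β n), onePointFunction_ae_eq Q n (β n)]
      with z h1 h2
    rwa [h2]
  · refine (tendsto_integral_gibbsMeasure hQ ha hC hσ hS hβ f).congr' ?_
    filter_upwards [hZ] with n hn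
    have := isProbabilityMeasure_gibbsMeasure hn.1 hn.2
    rw [integral_mul_onePointFunction, integral_const_mul]
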